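/- **Notation.** All Hilbert spaces are finite-dimensional complex spaces with a fixed basis; $\mathscr L(X)$, $\mathscr P(X)$ and $\mathscr D(X)$ denote the linear operators, the positive semidefinite operators and the density operators (positive semidefinite of trace one) on $X$. For $\alpha\in(1,\infty)$ and $\rho,\sigma\in\mathscr P(H)$ (not necessarily normalized) let $$\widetilde D_\alpha(\rho\|\sigma)=\frac1{\alpha-1}\log_2\operatorname{tr}\Big(\big(\sigma^{\frac{1-\alpha}{2\alpha}}\,\rho\,\sigma^{\frac{1-\alpha}{2\alpha}}\big)^{\alpha}\Big)\in[-\infty,\infty)$$ if $\operatorname{supp}\rho\subseteq\operatorname{supp}\sigma$ (negative powers of $\sigma$ are taken on its support, and $\log_2 0=-\infty$), and $\widetilde D_\alpha(\rho\|\sigma)=+\infty$ otherwise. For completely positive maps $\mathcal N,\mathcal M:\mathscr L(X')\to\mathscr L(Y)$ and a copy $X$ of $X'$, let $J^{\mathcal N}_{XY}=(\mathcal I_X\otimes\mathcal N)\big(\sum_{x,x'}|x\rangle\langle x'|_X\otimes|x\rangle\langle x'|_{X'}\big)$ be the Choi matrix of $\mathcal N$, and let $$\widetilde D_\alpha(\mathcal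 N\|\mathcal M)=\sup_{\omega\in\mathscr D(X)}\widetilde D_\alpha\big(\omega_X^{1/2}J^{\mathcal N}_{XY}\omega_X^{1/2}\,\big\|\,\omega_X^{1/2}J^{\mathcal M}_{XY}\omega_X^{1/2}\big),\qquad \widetilde D^{\mathrm{reg}}_\alpha(\mathcal N\|\mathcal M)=\lim_{n\to\infty}\frac1n\widetilde D_\alpha(\mathcal N^{\otimes n}\|\mathcal M^{\otimes n}).$$ **Corollary (chain rule for the sandwiched Rényi divergence).** Let $\alpha\in(1,\infty)$, let $\rho_{RX'},\sigma_{RX'}\in\mathscr P(R\otimes X')$, and let $\mathcal N,\mathcal M:\mathscr L(X')\to\mathscr L(Y)$ be completely positive maps. Then the limit defining $\widetilde D^{\mathrm{reg}}_\alpha(\mathcal N\|\mathcal M)$ exists in $[-\infty,\infty]$, and $$\widetilde D_\alpha\big((\mathcal I_R\otimes\mathcal N)(\rho_{RX'})\,\big\|\,(\mathcal I_R\otimes\mathcal M)(\sigma_{RX'})\big)\le\widetilde D^{\mathrm{reg}}_\alpha(\mathcal N\|\mathcal M)+\widetilde D_\alpha(\rho_{RX'}\|\sigma_{RX'}),$$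 where a sum of $-\infty$ and $+\infty$ is read as $-\infty$ (it can occur only if $\rho_{RX'}=0$ or $\mathcal N=0$, and then the left side is $-\infty$ as well). -/

import Mathlib

open Matrix Filter Topology
open scoped Kronecker ComplexOrder MatrixOrder Matrix.Norms.L2Operator CStarAlgebra

noncomputable section

namespace SandwichedRenyi

/-- Logarithm to base two of a nonnegative number, with `log 0 = -∞`. -/
def log2 (t : ℝ) : EReal := if 0 < t then ((Real.logb 2 t : ℝ) : EReal) else ⊥

/-- The support of a Hermitian matrix, i.e. its range (the orthogonal complement of its kernel). -/
def supp {d : Type*} [Fintype d] (A : Matrix d d ℂ) : Submodule ℂ (d → ℂ) := LinearMap.range A.mulVecLin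

open Classical in
/-- The sandwiched Rényi divergence of positive semidefinite matrices `ρ`, `σ`, with the same
expression whether or not `ρ` is normalized:
`(1 / (α - 1)) log tr (σ ^ ((1 - α) / (2 α)) ρ σ ^ ((1 - α) / (2 α))) ^ α` if
`supp ρ ⊆ supp σ`, and `+∞` otherwise.

Powers are those of the functional calculus. As `0 ^ s = 0` for every real `s ≠ 0`, a negative
power of `σ` is the power of the generalized inverse (the inverse on the support). -/
def sandwichedDiv {d : Type*} [Fintype d] [DecidableEq d] (α : ℝ)
    (ρ σ : Matrix d d ℂ) : EReal :=
  if supp ρ ≤ supp σ then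
    ((1 / (α - 1) : ℝ) : EReal) *
      log2 ((σ ^ ((1 - α) / (2 * α)) * ρ * σ ^ ((1 - α) / (2 * α))) ^ α).trace.re
  else ⊤

/-- The linear map `id ⊗ N`, which applies `N` to each block
`A_{(i, ·), (j, ·)}` of a matrix on the tensor product. -/
def idTensor {x y : Type*} (r : Type*) (N : Matrix x x ℂ →ₗ[ℂ] Matrix y y ℂ) :
    Matrix (r × x) (r × x) ℂ →ₗ[ℂ] Matrix (r × y) (r × y) ℂ where
  toFun A := Matrix.of fun p q => N (Matrix.of fun a b => A (p.1, a) (q.1, b)) p.2 q.2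
  map_add' A B := by
    ext p q
    exact congrFun (congrFun (N.map_add (Matrix.of fun a b => A (p.1, a) (q.1, b))
      (Matrix.of fun a b => B (p.1, a) (q.1, b))) p.2) q.2
  map_smul' c A := by
    ext p q
    exact congrFun (congrFun (N.map_smul c (Matrix.of fun a b => A (p.1, a) (q.1, b))) p.2) q.2

/-- `idTensor r N` is the map characterized by `A ⊗ B ↦ A ⊗ N B`. -/
theorem idTensor_kronecker {r x y : Type*} (N : Matrix x x ℂ →ₗ[ℂ] Matrix y y ℂ)
    (A : Matrix r r ℂ) (B : Matrix x x ℂ) : idTensor r N (A ⊗ₖ B) = A ⊗ₖ N B := by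
  ext p q
  exact congrFun (congrFun (N.map_smul (A p.1 q.1) B) p.2) q.2

/-- The `n`-fold tensor power of `N`, acting on matrices on the `n`-fold tensor power of `ℂ^x`
(whose standard basis is indexed by `Fin n → x`). It is given on matrix units by
`⊗ᵢ |aᵢ⟩⟨bᵢ| ↦ ⊗ᵢ N(|aᵢ⟩⟨bᵢ|)` and extended linearly. -/
def tensorPow {x y : Type*} [Fintype x] [DecidableEq x] (n : ℕ)
    (N : Matrix x x ℂ →ₗ[ℂ] Matrix y y ℂ) :
    Matrix (Fin n → x) (Fin n → x) ℂ →ₗ[ℂ] Matrix (Fin n → y) (Fin n → y) ℂ where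
  toFun A := Matrix.of fun u v =>
    ∑ a, ∑ b, A a b * ∏ i, N (Matrix.single (a i) (b i) 1) (u i) (v i)
  map_add' A B := by
    ext u v
    simp [add_mul, Finset.sum_add_distrib]
  map_smul' c A := by
    ext u v
    simp [Finset.mul_sum, mul_assoc]

/-- `tensorPow n N` is the map characterized by `⊗ᵢ Bᵢ ↦ ⊗ᵢ N Bᵢ`. -/
theorem tensorPow_prod {x y : Type*} [Fintype x] [DecidableEq x] (n : ℕ)
    (N : Matrix x x ℂ →ₗ[ℂ] Matrix y y ℂ)
    (B : Fin n → Matrix x x ℂ) :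
    tensorPow n N (Matrix.of fun a b => ∏ i, B i (a i) (b i)) =
      Matrix.of fun u v => ∏ i, N (B i) (u i) (v i) := by
  have key : ∀ (C : Matrix x x ℂ) (s t : y),
      N C s t = ∑ a, ∑ b, C a b * N (Matrix.single a b 1) s t := by
    intro C s t
    conv_lhs => rw [Matrix.matrix_eq_sum_single C]
    simp only [map_sum, Matrix.sum_apply]
    refine Finset.sum_congr rfl fun a _ => Finset.sum_congr rfl fun b _ => ?_
    have h : Matrix.single a b (C a b) = C a b • Matrix.single a b (1 : ℂ) := by simp
    rw [h, map_smul, Matrix.smul_apply, smul_eq_mul]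
  ext u v
  simp only [tensorPow, LinearMap.coe_mk, AddHom.coe_mk, Matrix.of_apply]
  simp_rw [key (B _), Finset.prod_univ_sum, Fintype.piFinset_univ, Finset.prod_mul_distrib]

/-- The unnormalized maximally entangled operator `∑ a b, |a⟩⟨b| ⊗ |a⟩⟨b|`. -/
def maxEntangled (x : Type*) [Fintype x] [DecidableEq x] : Matrix (x × x) (x × x) ℂ :=
  ∑ a, ∑ b, Matrix.single a b 1 ⊗ₖ Matrix.single a b 1

/-- The Choi matrix `(id ⊗ N)(∑ a b, |a⟩⟨b| ⊗ |a⟩⟨b|)`. -/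
def choi {x y : Type*} [Fintype x] [DecidableEq x] (N : Matrix x x ℂ →ₗ[ℂ] Matrix y y ℂ) :
    Matrix (x × y) (x × y) ℂ :=
  idTensor x N (maxEntangled x)

/-- The operator `ω^{1/2} ⊗ 1` on the tensor product. -/
def sqrtTensor {x : Type*} [Fintype x] [DecidableEq x] (y : Type*) [DecidableEq y]
    (ω : Matrix x x ℂ) : Matrix (x × y) (x × y) ℂ :=
  (ω ^ (1 / 2 : ℝ)) ⊗ₖ (1 : Matrix y y ℂ)

/-- The sandwiched Rényi channel divergence: the supremum over density matrices `ω` of the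
divergence between `ω^{1/2} J^N ω^{1/2}` and `ω^{1/2} J^M ω^{1/2}`, where `ω^{1/2}` stands for
`ω^{1/2} ⊗ 1` and `J` is the Choi matrix. -/
def sandwichedChannelDiv {x y : Type*} [Fintype x] [DecidableEq x] [Fintype y] [DecidableEq y]
    (α : ℝ) (N M : Matrix x x ℂ →ₗ[ℂ] Matrix y y ℂ) : EReal :=
  ⨆ (ω : Matrix x x ℂ) (_ : ω.PosSemidef ∧ ω.trace = 1),
    sandwichedDiv α
      (sqrtTensor y ω * choi N * sqrtTensor y ω)
      (sqrtTensor y ω * choi M * sqrtTensor y ω)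

/-- The sequence `(1 / n) D(N^{⊗ n} ‖ M^{⊗ n})`. -/
def channelDivSeq {x y : Type*} [Fintype x] [DecidableEq x] [Fintype y] [DecidableEq y]
    (α : ℝ) (N M : Matrix x x ℂ →ₗ[ℂ] Matrix y y ℂ) (n : ℕ) : EReal :=
  ((1 / n : ℝ) : EReal) * sandwichedChannelDiv α (tensorPow n N) (tensorPow n M)

/-- The regularized sandwiched Rényi channel divergence `lim_n (1 / n) D(N^{⊗ n} ‖ M^{⊗ n})`. -/
def regSandwichedChannelDiv {x y : Type*} [Fintype x] [DecidableEq x] [Fintype y] [DecidableEq y]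
    (α : ℝ) (N M : Matrix x x ℂ →ₗ[ℂ] Matrix y y ℂ) : EReal :=
  limUnder atTop (channelDivSeq α N M)

end SandwichedRenyi

end

/-! Write Q for the trace inside the divergence (`sandwichedTrace`); it is multiplicative under
tensor products, so the chain rule is a product bound Q(N ρ, M σ) ≤ B · Q(ρ, σ), where B = 2 ^ ((α -
1) l) and l is the regularized divergence. Polynomial losses in the n-fold version are harmless: the
n-th root removes them (`le_of_pow_le_rpow_mul_pow`).

The loss comes from pinching. If σ has at most T eigenvalues, some eigenbasis of σ also diagonalizes
the pinching of ρ, and ρ is at most T times that pinching (`exists_pinching`). Pinching never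
increases Q (Peierls' inequality), so Q agrees up to the factor T ^ α with the classical sum of p ^
α q ^ (1 - α). For n-th tensor powers T is polynomial in n, by counting types.

In the one-shot bound `sandwichedTrace_idTensor_le`, both inputs are replaced by mixtures of the
same pure states and both outputs are measured in one basis. Joint convexity of p ^ α q ^ (1 - α)
splits the classical sum into an input part, at most Q(ρ, σ), and for each pure state an output
part. A pure input is ω^{1/2} up to a partial isometry on the reference (`exists_polar`), so its
output part is a measured version of a term in the channel divergence. Monotonicity under
measurements (`sum_persp_measure_le`), itself obtained by pinching tensor powers, bounds it.

Product inputs make the channel divergences superadditive in n. Fekete's lemma then gives the limit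
and identifies it with a supremum, so l bounds every tensor power and the one-shot estimate applies
with Q-bound B ^ n. Infinite values and zero maps are treated separately. -/

noncomputable section

namespace SandwichedRenyi

set_option linter.unusedSectionVars false

/-! ### Functional calculus in an explicit eigenbasis -/

section Spectral

variable {ι κ : Type*} [Fintype ι] [DecidableEq ι] [Fintype κ] [DecidableEq κ]

/-- `U` is a unitary matrix whose rows and columns may have different index types. -/
structure IsUnitary (U : Matrix ι κ ℂ) : Prop where
  left : Uᴴ * U = 1
  right : U * Uᴴ = 1

/-- The matrix with eigenvalues `a` in the orthonormal basis of the columns of `U`. -/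
def conjDiag (U : Matrix ι κ ℂ) (a : κ → ℝ) : Matrix ι ι ℂ :=
  U * diagonal (fun k => (a k : ℂ)) * Uᴴ

/-- `conjDiag U` as an algebra homomorphism. -/
def conjDiagHom (U : Matrix ι κ ℂ) (hU : IsUnitary U) : (κ → ℝ) →ₐ[ℝ] Matrix ι ι ℂ where
  toFun := conjDiag U
  map_one' := by simp [conjDiag, hU.right]
  map_mul' a b := by
    have h : ∀ X Y : Matrix κ κ ℂ, U * X * Uᴴ * (U * Y * Uᴴ) = U * (X * Y) * Uᴴ := fun X Y => by
      calc U * X * Uᴴ * (U * Y * Uᴴ) = U * X * (Uᴴ * U) * Y * Uᴴ := by simp only [Matrix.mul_assoc]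
        _ = _ := by rw [hU.left]; simp only [Matrix.mul_assoc, Matrix.mul_one]
    simp [conjDiag, h]
  map_zero' := by simp [conjDiag]
  map_add' a b := by
    simp only [conjDiag, ← Matrix.add_mul, ← Matrix.mul_add, diagonal_add, Pi.add_apply,
      Complex.ofReal_add]
  commutes' c := by
    have : (diagonal fun k => ((algebraMap ℝ (κ → ℝ) c k : ℝ) : ℂ)) = (c : ℂ) • (1 : Matrix κ κ ℂ) := by
      ext i j; simp [diagonal_apply, Matrix.one_apply]
    rw [conjDiag, this]
    simp [hU.right, Algebra.algebraMap_eq_smul_one]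

theorem conjDiag_isHermitian (U : Matrix ι κ ℂ) (a : κ → ℝ) : (conjDiag U a).IsHermitian := by
  simp only [conjDiag, Matrix.IsHermitian, conjTranspose_mul, conjTranspose_conjTranspose,
    diagonal_conjTranspose, Matrix.mul_assoc]
  congr 3
  ext k; simp

theorem conjDiag_posSemidef (U : Matrix ι κ ℂ) {a : κ → ℝ} (ha : ∀ k, 0 ≤ a k) :
    (conjDiag U a).PosSemidef :=
  (PosSemidef.diagonal fun k => by simpa using ha k).mul_mul_conjTranspose_same U

/-- Only finitely many points matter, so `f` may be replaced by an interpolating polynomial, and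
polynomials commute with the algebra homomorphism `conjDiagHom`. Interpolating on the range of `a`
as well avoids identifying it with the spectrum. -/
theorem cfc_conjDiag {U : Matrix ι κ ℂ} (hU : IsUnitary U) (a : κ → ℝ) (f : ℝ → ℝ) :
    cfc f (conjDiag U a) = conjDiag U (fun k => f (a k)) := by
  have hsa : IsSelfAdjoint (conjDiag U a) := conjDiag_isHermitian U a
  obtain ⟨P, hP⟩ : ∃ P : Polynomial ℝ, ∀ t ∈ spectrum ℝ (conjDiag U a) ∪ Set.range a,
      P.eval t = f t := by
    have hfin : (spectrum ℝ (conjDiag U a) ∪ Set.range a).Finite :=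
      finite_real_spectrum.union (Set.finite_range a)
    refine ⟨Lagrange.interpolate hfin.toFinset id f, fun t ht => ?_⟩
    exact Lagrange.eval_interpolate_at_node (v := id) f Function.injective_id.injOn
      (hfin.mem_toFinset.2 ht)
  rw [cfc_congr (g := fun t => P.eval t) fun t ht => (hP t (Or.inl ht)).symm,
    cfc_polynomial P _ hsa]
  change Polynomial.aeval (conjDiagHom U hU a) P = conjDiagHom U hU fun k => f (a k)
  rw [Polynomial.aeval_algHom_apply]
  congr 1
  ext k
  rw [← hP (a k) (Or.inr ⟨k, rfl⟩)]
  simp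

theorem conjDiag_rpow {U : Matrix ι κ ℂ} (hU : IsUnitary U) {a : κ → ℝ} (ha : ∀ k, 0 ≤ a k) (s : ℝ) :
    conjDiag U a ^ s = conjDiag U (fun k => a k ^ s) := by
  rw [CFC.rpow_eq_cfc_real (nonneg_iff_posSemidef.2 (conjDiag_posSemidef U ha)), cfc_conjDiag hU]

theorem exists_conjDiag {A : Matrix ι ι ℂ} (hA : A.IsHermitian) :
    ∃ (U : Matrix ι ι ℂ) (a : ι → ℝ), IsUnitary U ∧ A = conjDiag U a := by
  refine ⟨hA.eigenvectorUnitary, hA.eigenvalues, ⟨?_, ?_⟩, ?_⟩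
  · exact Unitary.coe_star_mul_self hA.eigenvectorUnitary
  · exact Unitary.coe_mul_star_self hA.eigenvectorUnitary
  · conv_lhs => rw [hA.spectral_theorem]
    rfl

theorem conjTranspose_mul_conjDiag_mul {U : Matrix ι κ ℂ} (hU : IsUnitary U) (a : κ → ℝ) :
    Uᴴ * conjDiag U a * U = diagonal (fun k => (a k : ℂ)) := by
  simp only [conjDiag]
  calc _ = (Uᴴ * U) * diagonal (fun k => (a k : ℂ)) * (Uᴴ * U) := by simp only [Matrix.mul_assoc]
    _ = _ := by rw [hU.left]; simp

theorem nonneg_of_conjDiag_posSemidef {U : Matrix ι κ ℂ} (hU : IsUnitary U) {a : κ → ℝ}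
    (h : (conjDiag U a).PosSemidef) (k : κ) : 0 ≤ a k := by
  have := h.conjTranspose_mul_mul_same U
  rw [conjTranspose_mul_conjDiag_mul hU, posSemidef_diagonal_iff] at this
  simpa using this k

theorem exists_conjDiag_nonneg {A : Matrix ι ι ℂ} (hA : A.PosSemidef) :
    ∃ (U : Matrix ι ι ℂ) (a : ι → ℝ), IsUnitary U ∧ (∀ i, 0 ≤ a i) ∧ A = conjDiag U a := by
  obtain ⟨U, a, hU, h⟩ := exists_conjDiag hA.isHermitian
  exact ⟨U, a, hU, nonneg_of_conjDiag_posSemidef hU (h ▸ hA), h⟩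

theorem trace_conjDiag {U : Matrix ι κ ℂ} (hU : IsUnitary U) (a : κ → ℝ) :
    (conjDiag U a).trace = ∑ k, (a k : ℂ) := by
  rw [conjDiag, trace_mul_comm, ← Matrix.mul_assoc, hU.left, Matrix.one_mul, trace_diagonal]

end Spectral

/-! ### The classical summand and its joint convexity -/

section Perspective

/-- The summand `p ^ α * q ^ (1 - α)` of the classical Rényi divergence. -/
def persp (α p q : ℝ) : ℝ := p ^ α * q ^ (1 - α)

variable {α : ℝ}

theorem persp_nonneg {p q : ℝ} (hp : 0 ≤ p) (hq : 0 ≤ q) : 0 ≤ persp α p q := by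
  unfold persp; positivity

theorem persp_mul {a b p q : ℝ} (ha : 0 ≤ a) (hb : 0 ≤ b) (hp : 0 ≤ p) (hq : 0 ≤ q) :
    persp α (a * p) (b * q) = persp α a b * persp α p q := by
  rw [persp, Real.mul_rpow ha hp, Real.mul_rpow hb hq, persp, persp]; ring

theorem persp_self (hα : 1 < α) {c : ℝ} (hc : 0 ≤ c) : persp α c c = c := by
  rcases hc.eq_or_lt with rfl | hc
  · simp [persp, Real.zero_rpow (by linarith : α ≠ 0)]
  · rw [persp, ← Real.rpow_add hc]; simp

theorem persp_one_right (p : ℝ) : persp α p 1 = p ^ α := by simp [persp]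

theorem persp_mono (hα : 1 < α) {p p' q : ℝ} (hp : 0 ≤ p) (hq : 0 ≤ q) (h : p ≤ p') :
    persp α p q ≤ persp α p' q :=
  mul_le_mul_of_nonneg_right (Real.rpow_le_rpow hp h (by linarith)) (Real.rpow_nonneg hq _)

theorem persp_eq_mul_div (hα : 1 < α) {p q : ℝ} (hp : 0 ≤ p) (hq : 0 ≤ q) (h : q = 0 → p = 0) :
    persp α p q = q * (p / q) ^ α := by
  rcases hq.eq_or_lt with hq | hq
  · rw [h hq.symm, ← hq]
    simp [persp, Real.zero_rpow (by linarith : α ≠ 0)]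
  · rw [persp, Real.div_rpow hp hq.le, Real.rpow_sub hq, Real.rpow_one]; ring

/-- Joint convexity and homogeneity of the classical summand. -/
theorem persp_sum_le (hα : 1 < α) {ι : Type*} [Fintype ι] {p q : ι → ℝ} (hp : ∀ i, 0 ≤ p i)
    (hq : ∀ i, 0 ≤ q i) (h : ∀ i, q i = 0 → p i = 0) :
    persp α (∑ i, p i) (∑ i, q i) ≤ ∑ i, persp α (p i) (q i) := by
  have hQ : 0 ≤ ∑ i, q i := Finset.sum_nonneg fun i _ => hq i
  have hP : 0 ≤ ∑ i, p i := Finset.sum_nonneg fun i _ => hp i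
  have hz : ∑ i, q i = 0 → ∑ i, p i = 0 := fun h0 => by
    rw [Finset.sum_eq_zero_iff_of_nonneg fun i _ => hq i] at h0
    exact Finset.sum_eq_zero fun i hi => h i (h0 i hi)
  rcases hQ.eq_or_lt with h0 | h0
  · rw [hz h0.symm, persp, Real.zero_rpow (by linarith : α ≠ 0), zero_mul]
    exact Finset.sum_nonneg fun i _ => persp_nonneg (hp i) (hq i)
  · rw [persp_eq_mul_div hα hP hQ hz]
    have hw : ∑ i, q i / ∑ j, q j = 1 := by rw [← Finset.sum_div, div_self h0.ne']
    have key := Real.rpow_arith_mean_le_arith_mean_rpow Finset.univ (fun i => q i / ∑ j, q j)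
      (fun i => p i / q i) (fun i _ => div_nonneg (hq i) hQ) hw
      (fun i _ => div_nonneg (hp i) (hq i)) hα.le
    have e1 : ∑ i, q i / (∑ j, q j) * (p i / q i) = (∑ i, p i) / ∑ i, q i := by
      rw [Finset.sum_div]
      refine Finset.sum_congr rfl fun i _ => ?_
      -- Since division by zero gives `0`, a term with `q i = 0` vanishes on the left; absolute
      -- continuity makes its `p i` vanish on the right too.
      rcases (hq i).eq_or_lt with hi | hi
      · simp [h i hi.symm]
      · field_simp
    rw [e1] at key
    calc _ ≤ (∑ i, q i) * ∑ i, q i / (∑ j, q j) * (p i / q i) ^ α :=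
          mul_le_mul_of_nonneg_left key hQ
      _ = _ := by
        rw [Finset.mul_sum]
        refine Finset.sum_congr rfl fun i _ => ?_
        rw [persp_eq_mul_div hα (hp i) (hq i) (h i)]
        field_simp

/-- The form needed after pinching: the first argument is only bounded by `c` times a mixture, `c`
being a number of eigenspaces, while the second is the mixture exactly. -/
theorem persp_le_mul_sum (hα : 1 < α) {ι : Type*} [Fintype ι] {p q : ι → ℝ} (hp : ∀ i, 0 ≤ p i)
    (hq : ∀ i, 0 ≤ q i) (h : ∀ i, q i = 0 → p i = 0) {X c : ℝ} (hX : 0 ≤ X) (hc : 0 ≤ c)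
    (hXc : X ≤ c * ∑ i, p i) :
    persp α X (∑ i, q i) ≤ c ^ α * ∑ i, persp α (p i) (q i) := by
  have hP : 0 ≤ ∑ i, p i := Finset.sum_nonneg fun i _ => hp i
  have hQ : 0 ≤ ∑ i, q i := Finset.sum_nonneg fun i _ => hq i
  calc persp α X (∑ i, q i) ≤ persp α (c * ∑ i, p i) (1 * ∑ i, q i) := by
        rw [one_mul]; exact persp_mono hα hX hQ hXc
    _ = c ^ α * persp α (∑ i, p i) (∑ i, q i) := by
        rw [persp_mul hc zero_le_one hP hQ, persp_one_right]
    _ ≤ _ := mul_le_mul_of_nonneg_left (persp_sum_le hα hp hq h) (Real.rpow_nonneg hc _)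

end Perspective

/-! ### Peierls' inequality and monotonicity of the trace of a power -/

section Peierls

variable {ι κ η : Type*} [Fintype ι] [DecidableEq ι] [Fintype κ] [DecidableEq κ]
  [Fintype η] [DecidableEq η]

theorem IsUnitary.conjTranspose {U : Matrix ι κ ℂ} (hU : IsUnitary U) : IsUnitary Uᴴ :=
  ⟨by simpa using hU.right, by simpa using hU.left⟩

theorem IsUnitary.mul {U : Matrix ι κ ℂ} {V : Matrix κ η ℂ} (hU : IsUnitary U)
    (hV : IsUnitary V) : IsUnitary (U * V) := by
  constructor
  · rw [conjTranspose_mul, Matrix.mul_assoc, ← Matrix.mul_assoc Uᴴ, hU.left, Matrix.one_mul, hV.left]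
  · rw [conjTranspose_mul, Matrix.mul_assoc, ← Matrix.mul_assoc V, hV.right, Matrix.one_mul, hU.right]

theorem mul_conjDiag_mul (W : Matrix η ι ℂ) (U : Matrix ι κ ℂ) (a : κ → ℝ) :
    W * conjDiag U a * Wᴴ = conjDiag (W * U) a := by
  simp only [conjDiag, conjTranspose_mul, Matrix.mul_assoc]

theorem conjDiag_mul_conjDiag {U : Matrix ι κ ℂ} (hU : IsUnitary U) (a b : κ → ℝ) :
    conjDiag U a * conjDiag U b = conjDiag U (fun k => a k * b k) :=
  ((conjDiagHom U hU).map_mul a b).symm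

theorem conjDiag_apply_self (U : Matrix ι κ ℂ) (a : κ → ℝ) (i : ι) :
    conjDiag U a i i = ((∑ k, Complex.normSq (U i k) * a k : ℝ) : ℂ) := by
  rw [conjDiag, Matrix.mul_apply]
  push_cast
  refine Finset.sum_congr rfl fun k _ => ?_
  rw [mul_diagonal, conjTranspose_apply, Complex.normSq_eq_conj_mul_self]
  simp only [RCLike.star_def]; ring

theorem IsUnitary.sum_normSq_row {U : Matrix ι κ ℂ} (hU : IsUnitary U) (i : ι) :
    ∑ k, Complex.normSq (U i k) = 1 := by
  have h := congrFun (congrFun hU.right i) i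
  rw [Matrix.mul_apply, one_apply_eq] at h
  have : ((∑ k, Complex.normSq (U i k) : ℝ) : ℂ) = 1 := by
    rw [← h]; push_cast
    refine Finset.sum_congr rfl fun k _ => ?_
    rw [conjTranspose_apply, Complex.normSq_eq_conj_mul_self, mul_comm]; rfl
  exact_mod_cast this

theorem IsUnitary.sum_normSq_col {U : Matrix ι κ ℂ} (hU : IsUnitary U) (k : κ) :
    ∑ i, Complex.normSq (U i k) = 1 := by
  simpa [Complex.normSq_conj] using hU.conjTranspose.sum_normSq_row k

theorem PosSemidef.diag_re_nonneg {A : Matrix ι ι ℂ} (hA : A.PosSemidef) (i : ι) :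
    0 ≤ (A i i).re := (Complex.le_def.1 hA.diag_nonneg).1

theorem PosSemidef.ofReal_diag_re {A : Matrix ι ι ℂ} (hA : A.PosSemidef) (i : ι) :
    ((A i i).re : ℂ) = A i i := by
  have h := (Complex.le_def.1 (hA.diag_nonneg (i := i))).2
  exact Complex.ext rfl (by simpa using h)

theorem trace_rpow_conjDiag {U : Matrix ι κ ℂ} (hU : IsUnitary U) {a : κ → ℝ}
    (ha : ∀ k, 0 ≤ a k) (s : ℝ) : (conjDiag U a ^ s).trace.re = ∑ k, a k ^ s := by
  rw [conjDiag_rpow hU ha, trace_conjDiag hU]; simp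

/-- **Peierls' inequality** for the power `α`. -/
theorem sum_diag_rpow_le {α : ℝ} (hα : 1 < α) {A : Matrix ι ι ℂ} (hA : A.PosSemidef)
    {W : Matrix ι κ ℂ} (hW : IsUnitary W) :
    ∑ k, ((Wᴴ * A * W) k k).re ^ α ≤ (A ^ α).trace.re := by
  obtain ⟨U, a, hU, ha, rfl⟩ := exists_conjDiag_nonneg hA
  have hG := hW.conjTranspose.mul hU
  have e : Wᴴ * conjDiag U a * W = conjDiag (Wᴴ * U) a := by
    simpa using mul_conjDiag_mul Wᴴ U a
  rw [e, trace_rpow_conjDiag hU ha]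
  -- The squared overlaps form a doubly stochastic matrix: unit row sums allow Jensen, unit column
  -- sums give back the trace.
  calc _ ≤ ∑ k, ∑ j, Complex.normSq ((Wᴴ * U) k j) * a j ^ α := by
        refine Finset.sum_le_sum fun k _ => ?_
        rw [conjDiag_apply_self, Complex.ofReal_re]
        exact Real.rpow_arith_mean_le_arith_mean_rpow Finset.univ _ _
          (fun j _ => Complex.normSq_nonneg _) (hG.sum_normSq_row k) (fun j _ => ha j) hα.le
    _ = _ := by
        rw [Finset.sum_comm]
        refine Finset.sum_congr rfl fun j _ => ?_
        rw [← Finset.sum_mul, hG.sum_normSq_col, one_mul]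

/-- Peierls' inequality in an eigenbasis of `A` reduces the claim to diagonal entries. This matters
because `t ^ α` with `α > 1` is not operator monotone. -/
theorem trace_rpow_mono {α : ℝ} (hα : 1 < α) {A B : Matrix ι ι ℂ} (hA : A.PosSemidef)
    (hB : B.PosSemidef) (h : (B - A).PosSemidef) : (A ^ α).trace.re ≤ (B ^ α).trace.re := by
  obtain ⟨U, a, hU, ha, rfl⟩ := exists_conjDiag_nonneg hA
  refine le_trans ?_ (sum_diag_rpow_le hα hB hU)
  rw [trace_rpow_conjDiag hU ha]
  refine Finset.sum_le_sum fun k _ => Real.rpow_le_rpow (ha k) ?_ (by linarith)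
  have := PosSemidef.diag_re_nonneg (h.conjTranspose_mul_mul_same U) k
  rw [Matrix.mul_sub, Matrix.sub_mul, conjTranspose_mul_conjDiag_mul hU] at this
  simpa using this

end Peierls

/-! ### The trace functional and commuting arguments -/

section TraceFunctional

variable {ι κ : Type*} [Fintype ι] [DecidableEq ι] [Fintype κ] [DecidableEq κ] {α : ℝ}

/-- The trace `tr (σ ^ ((1 - α) / (2 α)) ρ σ ^ ((1 - α) / (2 α))) ^ α`. -/
def sandwichedTrace (α : ℝ) (ρ σ : Matrix ι ι ℂ) : ℝ :=
  ((σ ^ ((1 - α) / (2 * α)) * ρ * σ ^ ((1 - α) / (2 * α))) ^ α).trace.re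

theorem rpow_posSemidef (A : Matrix ι ι ℂ) (s : ℝ) : (A ^ s).PosSemidef :=
  nonneg_iff_posSemidef.1 CFC.rpow_nonneg

theorem PosSemidef.conj_rpow {A : Matrix ι ι ℂ} (hA : A.PosSemidef) (B : Matrix ι ι ℂ) (s : ℝ) :
    (B ^ s * A * B ^ s).PosSemidef := by
  have := hA.mul_mul_conjTranspose_same (B ^ s)
  rwa [(rpow_posSemidef B s).isHermitian.eq] at this

theorem trace_re_nonneg {A : Matrix ι ι ℂ} (hA : A.PosSemidef) : 0 ≤ A.trace.re :=
  (Complex.le_def.1 hA.trace_nonneg).1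

theorem sandwichedTrace_nonneg (ρ σ : Matrix ι ι ℂ) : 0 ≤ sandwichedTrace α ρ σ :=
  trace_re_nonneg (rpow_posSemidef _ _)

theorem sandwichedTrace_mono (hα : 1 < α) {ρ ρ' : Matrix ι ι ℂ} (σ : Matrix ι ι ℂ)
    (hρ : ρ.PosSemidef) (h : (ρ' - ρ).PosSemidef) :
    sandwichedTrace α ρ σ ≤ sandwichedTrace α ρ' σ := by
  have hρ' : ρ'.PosSemidef := by simpa using h.add hρ
  refine trace_rpow_mono hα (PosSemidef.conj_rpow hρ _ _) (PosSemidef.conj_rpow hρ' _ _) ?_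
  rw [← Matrix.sub_mul, ← Matrix.mul_sub]
  exact PosSemidef.conj_rpow h _ _

theorem persp_exponent (hα : 1 < α) {p q : ℝ} (hp : 0 ≤ p) (hq : 0 ≤ q) :
    (q ^ ((1 - α) / (2 * α)) * p * q ^ ((1 - α) / (2 * α))) ^ α = persp α p q := by
  have h : 0 ≤ q ^ ((1 - α) / (2 * α)) := Real.rpow_nonneg hq _
  have e : (q ^ ((1 - α) / (2 * α))) ^ α = q ^ ((1 - α) / 2) := by
    rw [← Real.rpow_mul hq]; congr 1; field_simp
  rw [Real.mul_rpow (by positivity) h, Real.mul_rpow h hp, e, persp]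
  have : q ^ (1 - α) = q ^ ((1 - α) / 2) * q ^ ((1 - α) / 2) := by
    rw [← Real.rpow_add' hq (by linarith)]; congr 1; ring
  rw [this]; ring

theorem sandwichedTrace_conjDiag (hα : 1 < α) {U : Matrix ι κ ℂ} (hU : IsUnitary U) {p q : κ → ℝ}
    (hp : ∀ k, 0 ≤ p k) (hq : ∀ k, 0 ≤ q k) :
    sandwichedTrace α (conjDiag U p) (conjDiag U q) = ∑ k, persp α (p k) (q k) := by
  rw [sandwichedTrace, conjDiag_rpow hU hq, conjDiag_mul_conjDiag hU, conjDiag_mul_conjDiag hU,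
    trace_rpow_conjDiag hU]
  · exact Finset.sum_congr rfl fun k _ => persp_exponent hα (hp k) (hq k)
  · intro k
    have := hp k
    have := Real.rpow_nonneg (hq k) ((1 - α) / (2 * α))
    positivity

/-- Pinching in an eigenbasis of `σ` does not increase the trace functional. -/
theorem sum_persp_diag_le (hα : 1 < α) {U : Matrix ι κ ℂ} (hU : IsUnitary U) {q : κ → ℝ}
    (hq : ∀ k, 0 ≤ q k) {ρ : Matrix ι ι ℂ} (hρ : ρ.PosSemidef) :
    ∑ k, persp α ((Uᴴ * ρ * U) k k).re (q k) ≤ sandwichedTrace α ρ (conjDiag U q) := by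
  refine le_trans (le_of_eq ?_) (sum_diag_rpow_le hα (PosSemidef.conj_rpow hρ _ _) hU)
  refine Finset.sum_congr rfl fun k _ => ?_
  rw [← persp_exponent hα (PosSemidef.diag_re_nonneg (hρ.conjTranspose_mul_mul_same U) k) (hq k),
    conjDiag_rpow hU hq]
  congr 1
  have e : Uᴴ * (conjDiag U (fun k => q k ^ ((1 - α) / (2 * α))) * ρ *
      conjDiag U (fun k => q k ^ ((1 - α) / (2 * α)))) * U =
      diagonal (fun k => ((q k ^ ((1 - α) / (2 * α)) : ℝ) : ℂ)) * (Uᴴ * ρ * U) *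
        diagonal (fun k => ((q k ^ ((1 - α) / (2 * α)) : ℝ) : ℂ)) := by
    simp only [conjDiag]
    calc _ = (Uᴴ * U) * diagonal (fun k => ((q k ^ ((1 - α) / (2 * α)) : ℝ) : ℂ)) * (Uᴴ * ρ * U) *
          diagonal (fun k => ((q k ^ ((1 - α) / (2 * α)) : ℝ) : ℂ)) * (Uᴴ * U) := by
          simp only [Matrix.mul_assoc]
      _ = _ := by rw [hU.left]; simp
  rw [e, mul_diagonal, diagonal_mul]
  simp

end TraceFunctional

/-! ### Pinching along eigenspaces -/

section Pinching

variable {ι T : Type*} [Fintype ι] [DecidableEq ι] [Fintype T] [DecidableEq T]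
  {m : T → Type*} [∀ c, Fintype (m c)] [∀ c, DecidableEq (m c)] {α : ℝ}

/-- The block diagonal part of a matrix. -/
def blockPart (A : Matrix (Σ c, m c) (Σ c, m c) ℂ) : Matrix (Σ c, m c) (Σ c, m c) ℂ :=
  blockDiagonal' fun c => A.submatrix (Sigma.mk c) (Sigma.mk c)

theorem blockPart_apply (A : Matrix (Σ c, m c) (Σ c, m c) ℂ) (i j : Σ c, m c) :
    blockPart A i j = if i.1 = j.1 then A i j else 0 := by
  obtain ⟨c, i⟩ := i
  obtain ⟨c', j⟩ := j
  by_cases h : c = c'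
  · subst h; simp [blockPart]
  · simp [blockPart, blockDiagonal'_apply_ne _ _ _ h, h]

/-- The pinching inequality. -/
theorem card_smul_blockPart_sub_posSemidef {A : Matrix (Σ c, m c) (Σ c, m c) ℂ}
    (hA : A.PosSemidef) : ((Fintype.card T : ℝ) • blockPart A - A).PosSemidef := by
  -- With `P c` the block projections, `D c c' = P c - P c'`. Summing `D c c' * A * D c c'` over all
  -- pairs gives twice `card T` times the block part minus twice `A`.
  let D : T → T → Matrix (Σ c, m c) (Σ c, m c) ℂ := fun c c' =>
    diagonal fun i => (if i.1 = c then 1 else 0) - (if i.1 = c' then 1 else 0)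
  have key : (Fintype.card T : ℝ) • blockPart A - A =
      (1 / 2 : ℝ) • ∑ c, ∑ c', D c c' * A * (D c c')ᴴ := by
    ext i j
    simp only [D, diagonal_conjTranspose, Matrix.sub_apply, Matrix.smul_apply, Matrix.sum_apply,
      mul_diagonal, diagonal_mul, blockPart_apply, Pi.star_apply, star_sub, apply_ite star, star_one,
      star_zero]
    have : ∀ c c' : T, ((if i.1 = c then (1 : ℂ) else 0) - (if i.1 = c' then 1 else 0)) * A i j *
        ((if j.1 = c then 1 else 0) - (if j.1 = c' then 1 else 0)) =
        (if i.1 = c then if j.1 = c then A i j else 0 else 0)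
        - (if i.1 = c then if j.1 = c' then A i j else 0 else 0)
        - (if i.1 = c' then if j.1 = c then A i j else 0 else 0)
        + (if i.1 = c' then if j.1 = c' then A i j else 0 else 0) := by
      intro c c'
      split_ifs <;> ring
    simp only [this, Finset.sum_add_distrib, Finset.sum_sub_distrib, Finset.sum_ite_eq,
      Finset.sum_const, Finset.mem_univ, if_true, Finset.card_univ]
    by_cases h : i.1 = j.1
    · simp [h]; ring
    · simp [h, Ne.symm h]; ring
  rw [key]
  refine PosSemidef.smul (posSemidef_sum _ fun c _ => posSemidef_sum _ fun c' _ =>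
    hA.mul_mul_conjTranspose_same _) (by norm_num)

theorem exists_blockDiagonal_conjDiag {A : Matrix (Σ c, m c) (Σ c, m c) ℂ} (hA : A.IsHermitian) :
    ∃ (V : ∀ c, Matrix (m c) (m c) ℂ) (p : (Σ c, m c) → ℝ),
      IsUnitary (blockDiagonal' V) ∧ blockPart A = conjDiag (blockDiagonal' V) p := by
  choose V a hV ha using fun c => exists_conjDiag (hA.submatrix (Sigma.mk (β := m) c))
  refine ⟨V, fun i => a i.1 i.2, ⟨?_, ?_⟩, ?_⟩
  · rw [blockDiagonal'_conjTranspose, ← blockDiagonal'_mul]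
    simp only [(hV _).left]
    exact blockDiagonal'_one
  · rw [blockDiagonal'_conjTranspose, ← blockDiagonal'_mul]
    simp only [(hV _).right]
    exact blockDiagonal'_one
  · have : (diagonal fun i : Σ c, m c => ((a i.1 i.2 : ℝ) : ℂ)) =
        blockDiagonal' fun c => diagonal fun k => ((a c k : ℝ) : ℂ) := by
      rw [blockDiagonal'_diagonal]
    rw [conjDiag, this, blockDiagonal'_conjTranspose, ← blockDiagonal'_mul, ← blockDiagonal'_mul,
      blockPart]
    congr 1
    funext c
    exact ha c

/-- A diagonal entry in a block diagonal basis involves one block only. Hence the eigenvalues of the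
pinched matrix can be read off the unpinched one. -/
theorem blockPart_conj_blockDiagonal (V : ∀ c, Matrix (m c) (m c) ℂ)
    (A : Matrix (Σ c, m c) (Σ c, m c) ℂ) (i : Σ c, m c) :
    ((blockDiagonal' V)ᴴ * A * blockDiagonal' V) i i =
      ((blockDiagonal' V)ᴴ * blockPart A * blockDiagonal' V) i i := by
  simp only [Matrix.mul_apply, Finset.sum_mul]
  refine Finset.sum_congr rfl fun j _ => Finset.sum_congr rfl fun k _ => ?_
  obtain ⟨c, i⟩ := i
  obtain ⟨c', j⟩ := j
  obtain ⟨c'', k⟩ := k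
  rw [conjTranspose_apply]
  by_cases h : c'' = c
  · by_cases h' : c' = c
    · subst h; subst h'; simp [blockPart_apply]
    · rw [blockDiagonal'_apply_ne _ _ _ h']; simp
  · rw [blockDiagonal'_apply_ne _ k _ h]; simp

/-- A common eigenbasis of `σ` and of the pinching of `ρ` along the eigenspaces of `σ`. -/
theorem exists_pinching {W : Matrix ι (Σ c, m c) ℂ} (hW : IsUnitary W) (g : T → ℝ)
    {ρ : Matrix ι ι ℂ} (hρ : ρ.PosSemidef) :
    ∃ U : Matrix ι (Σ c, m c) ℂ, IsUnitary U ∧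
      conjDiag W (fun i => g i.1) = conjDiag U (fun i => g i.1) ∧
      (conjDiag U (fun i => Fintype.card T * ((Uᴴ * ρ * U) i i).re) - ρ).PosSemidef := by
  have hA := hρ.conjTranspose_mul_mul_same W
  obtain ⟨V, p, hV, hp⟩ := exists_blockDiagonal_conjDiag hA.isHermitian
  have hU := hW.mul hV
  refine ⟨W * blockDiagonal' V, hU, ?_, ?_⟩
  · rw [← mul_conjDiag_mul, conjDiag]
    congr 2
    -- The matrix is scalar on each block, so rotating the basis inside the blocks leaves it
    -- unchanged.
    have : (diagonal fun i : Σ c, m c => (g i.1 : ℂ)) =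
        blockDiagonal' fun c => (g c : ℂ) • (1 : Matrix (m c) (m c) ℂ) := by
      simp only [smul_one_eq_diagonal]
      rw [blockDiagonal'_diagonal]
    have hl : ∀ c, V c * (V c)ᴴ = 1 := fun c => by
      have := hV.right
      rw [blockDiagonal'_conjTranspose, ← blockDiagonal'_mul, ← blockDiagonal'_one,
        blockDiagonal'_inj] at this
      exact congrFun this c
    rw [conjDiag, this, blockDiagonal'_conjTranspose, ← blockDiagonal'_mul, ← blockDiagonal'_mul]
    congr 1
    funext c
    simp [hl]
  · have e : ∀ i, (((W * blockDiagonal' V)ᴴ * ρ * (W * blockDiagonal' V)) i i).re = p i := by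
      intro i
      have : (W * blockDiagonal' V)ᴴ * ρ * (W * blockDiagonal' V) =
          (blockDiagonal' V)ᴴ * (Wᴴ * ρ * W) * blockDiagonal' V := by
        simp only [conjTranspose_mul, Matrix.mul_assoc]
      rw [this, blockPart_conj_blockDiagonal, hp, conjTranspose_mul_conjDiag_mul hV]
      simp
    simp only [e]
    have h := (card_smul_blockPart_sub_posSemidef hA).mul_mul_conjTranspose_same W
    rw [Matrix.mul_sub, Matrix.sub_mul, hp] at h
    convert h using 2
    · rw [Matrix.mul_smul, Matrix.smul_mul, mul_conjDiag_mul]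
      have := map_smul (conjDiagHom _ hU) (Fintype.card T : ℝ) p
      exact this
    · calc ρ = (W * Wᴴ) * ρ * (W * Wᴴ) := by rw [hW.right]; simp
        _ = _ := by simp only [Matrix.mul_assoc]

/-- Converse to `sum_persp_diag_le` up to the factor `c ^ α`: the dominating matrix commutes with
the second argument, so its trace functional is the classical sum. -/
theorem sandwichedTrace_le_sum_persp {κ : Type*} [Fintype κ] [DecidableEq κ] (hα : 1 < α)
    {U : Matrix ι κ ℂ} (hU : IsUnitary U) {c : ℝ} (hc : 0 ≤ c) {q : κ → ℝ} (hq : ∀ i, 0 ≤ q i)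
    {ρ : Matrix ι ι ℂ} (hρ : ρ.PosSemidef)
    (h : (conjDiag U (fun i => c * ((Uᴴ * ρ * U) i i).re) - ρ).PosSemidef) :
    sandwichedTrace α ρ (conjDiag U q) ≤
      c ^ α * ∑ i, persp α ((Uᴴ * ρ * U) i i).re (q i) := by
  have hp := fun i => PosSemidef.diag_re_nonneg (hρ.conjTranspose_mul_mul_same U) i
  refine (sandwichedTrace_mono hα _ hρ h).trans (le_of_eq ?_)
  rw [sandwichedTrace_conjDiag hα hU (fun i => mul_nonneg hc (hp i)) hq, Finset.mul_sum]
  refine Finset.sum_congr rfl fun i _ => ?_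
  rw [← persp_one_right (α := α) c, ← persp_mul hc zero_le_one (hp i) (hq i), one_mul]

end Pinching

/-! ### Support inclusion as an order bound -/

section Domination

variable {ι κ : Type*} [Fintype ι] [DecidableEq ι] [Fintype κ] [DecidableEq κ]

/-- `ρ ≤ c σ` for some `c ≥ 0`. -/
def Dom (ρ σ : Matrix ι ι ℂ) : Prop := ∃ c : ℝ, 0 ≤ c ∧ (c • σ - ρ).PosSemidef

theorem Dom.conj {ρ σ : Matrix ι ι ℂ} (h : Dom ρ σ) (B : Matrix κ ι ℂ) :
    Dom (B * ρ * Bᴴ) (B * σ * Bᴴ) := by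
  obtain ⟨c, hc, h⟩ := h
  refine ⟨c, hc, ?_⟩
  have := h.mul_mul_conjTranspose_same B
  rwa [Matrix.mul_sub, Matrix.sub_mul, Matrix.mul_smul, Matrix.smul_mul] at this

theorem Dom.submatrix {ρ σ : Matrix ι ι ℂ} (h : Dom ρ σ) (e : κ → ι) :
    Dom (ρ.submatrix e e) (σ.submatrix e e) := by
  obtain ⟨c, hc, h⟩ := h
  exact ⟨c, hc, h.submatrix e⟩

theorem Dom.diag_eq_zero {ρ σ : Matrix ι ι ℂ} (h : Dom ρ σ) (hρ : ρ.PosSemidef) {i : ι}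
    (hi : (σ i i).re = 0) : (ρ i i).re = 0 := by
  obtain ⟨c, hc, h⟩ := h
  have h1 := PosSemidef.diag_re_nonneg h i
  have h2 := PosSemidef.diag_re_nonneg hρ i
  simp [hi] at h1
  linarith

theorem supp_le_iff_exists_mul {ρ σ : Matrix ι ι ℂ} : supp ρ ≤ supp σ ↔ ∃ Z, ρ = σ * Z := by
  constructor
  · intro h
    have : ∀ j, ∃ z, σ *ᵥ z = ρ *ᵥ Pi.single j 1 := fun j => h ⟨Pi.single j 1, rfl⟩
    choose z hz using this
    refine ⟨of fun i j => z j i, ?_⟩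
    ext i j
    have := congrFun (hz j) i
    rw [mulVec_single_one] at this
    exact this.symm
  · rintro ⟨Z, rfl⟩ _ ⟨v, rfl⟩
    exact ⟨Z *ᵥ v, by simp⟩

theorem PosSemidef.le_smul_one {A : Matrix ι ι ℂ} (hA : A.PosSemidef) :
    ∃ c : ℝ, 0 ≤ c ∧ (c • (1 : Matrix ι ι ℂ) - A).PosSemidef := by
  obtain ⟨V, a, hV, ha, rfl⟩ := exists_conjDiag_nonneg hA
  refine ⟨∑ i, a i, Finset.sum_nonneg fun i _ => ha i, ?_⟩
  have : (∑ i, a i) • (1 : Matrix ι ι ℂ) - conjDiag V a = conjDiag V (fun k => (∑ i, a i) - a k) := by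
    have h1 := (conjDiagHom V hV).commutes (∑ i, a i)
    have h2 := map_sub (conjDiagHom V hV) (algebraMap ℝ (ι → ℝ) (∑ i, a i)) a
    rw [h1] at h2
    rw [← Algebra.algebraMap_eq_smul_one]
    exact h2.symm.trans (congrArg (conjDiag V) (funext fun k => by simp))
  rw [this]
  exact conjDiag_posSemidef V fun k =>
    sub_nonneg.2 (Finset.single_le_sum (fun i _ => ha i) (Finset.mem_univ k))

theorem PosSemidef.row_eq_zero {A : Matrix ι ι ℂ} (hA : A.PosSemidef) {i : ι} (hi : A i i = 0)
    (j : ι) : A i j = 0 := by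
  have h : A *ᵥ Pi.single i 1 = 0 := by
    rw [← hA.dotProduct_mulVec_zero_iff]
    simp [hi]
  have h2 := congrFun h j
  rw [mulVec_single_one] at h2
  rw [← hA.isHermitian.apply i j]
  simpa using h2

/-- The order form passes through congruences and positive maps, which makes it the working version
of the support condition. In an eigenbasis of `σ`, both sides say that the rows of `ρ` at zero
eigenvalues vanish. -/
theorem supp_le_iff_dom {ρ σ : Matrix ι ι ℂ} (hρ : ρ.PosSemidef) (hσ : σ.PosSemidef) :
    supp ρ ≤ supp σ ↔ Dom ρ σ := by
  rw [supp_le_iff_exists_mul]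
  obtain ⟨U, q, hU, hq, rfl⟩ := exists_conjDiag_nonneg hσ
  have hG := hρ.conjTranspose_mul_mul_same U
  have hρG : ρ = U * (Uᴴ * ρ * U) * Uᴴ := by
    calc ρ = (U * Uᴴ) * ρ * (U * Uᴴ) := by rw [hU.right]; simp
      _ = _ := by simp only [Matrix.mul_assoc]
  constructor
  · rintro ⟨Z, hZ⟩
    have hrow : ∀ i, q i = 0 → ∀ j, (Uᴴ * ρ * U) i j = 0 := by
      intro i hi j
      have : Uᴴ * ρ * U = diagonal (fun k => (q k : ℂ)) * (Uᴴ * Z * U) := by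
        rw [hZ, conjDiag]
        calc _ = (Uᴴ * U) * diagonal (fun k => (q k : ℂ)) * (Uᴴ * Z * U) := by
              simp only [Matrix.mul_assoc]
          _ = _ := by rw [hU.left]; simp
      rw [this, diagonal_mul, hi]; simp
    obtain ⟨c, hc, hcG⟩ := PosSemidef.le_smul_one hG
    -- As `0⁻¹ = 0`, the sum skips the kernel of `σ`; it dominates `c / q k` for all nonzero `q k`
    -- at once.
    have hsum : 0 ≤ ∑ j, c * (q j)⁻¹ :=
      Finset.sum_nonneg fun j _ => mul_nonneg hc (inv_nonneg.2 (hq j))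
    refine ⟨∑ j, c * (q j)⁻¹, hsum, ?_⟩
    let P : Matrix ι ι ℂ := diagonal fun i => if q i = 0 then 0 else 1
    have hP : P * (Uᴴ * ρ * U) * Pᴴ = Uᴴ * ρ * U := by
      ext i j
      simp only [P, diagonal_conjTranspose, mul_diagonal, diagonal_mul, Pi.star_apply]
      by_cases hi : q i = 0
      · simp [hrow i hi]
      · by_cases hj : q j = 0
        · have := hG.isHermitian.apply i j
          rw [hrow j hj] at this
          rw [← this]; simp
        · simp [hi, hj]
    have h1 := hcG.mul_mul_conjTranspose_same P
    rw [Matrix.mul_sub, Matrix.sub_mul, hP] at h1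
    have h2 : (diagonal (fun k => (((∑ j, c * (q j)⁻¹) * q k : ℝ) : ℂ)) -
        P * (c • 1) * Pᴴ).PosSemidef := by
      have : diagonal (fun k => (((∑ j, c * (q j)⁻¹) * q k : ℝ) : ℂ)) - P * (c • 1) * Pᴴ =
          diagonal (fun k => (((∑ j, c * (q j)⁻¹) * q k - if q k = 0 then 0 else c : ℝ) : ℂ)) := by
        ext i j
        by_cases hij : i = j
        · subst hij
          by_cases hi : q i = 0
          · simp [P, hi, diagonal_conjTranspose]
          · simp [P, hi, diagonal_conjTranspose]
        · simp [P, hij, diagonal_conjTranspose]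
      rw [this]
      refine PosSemidef.diagonal fun k => ?_
      simp only [Pi.zero_apply, Complex.zero_le_real]
      by_cases hk : q k = 0
      · simp [hk]
      · rw [if_neg hk, sub_nonneg]
        calc c = c * (q k)⁻¹ * q k := by field_simp
          _ ≤ _ := mul_le_mul_of_nonneg_right (Finset.single_le_sum
            (f := fun j => c * (q j)⁻¹) (fun j _ => mul_nonneg hc (inv_nonneg.2 (hq j)))
            (Finset.mem_univ k)) (hq k)
    have h3 := (h2.add h1).mul_mul_conjTranspose_same U
    rw [sub_add_sub_cancel, Matrix.mul_sub, Matrix.sub_mul, ← hρG] at h3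
    convert h3 using 2
    exact (map_smul (conjDiagHom U hU) (∑ j, c * (q j)⁻¹) q).symm
  · intro h
    have hrow : ∀ i, q i = 0 → ∀ j, (Uᴴ * ρ * U) i j = 0 := by
      intro i hi
      refine PosSemidef.row_eq_zero hG ?_
      rw [← PosSemidef.ofReal_diag_re hG]
      have h' := h.conj Uᴴ
      rw [conjTranspose_conjTranspose, conjTranspose_mul_conjDiag_mul hU] at h'
      rw [h'.diag_eq_zero hG (by simp [hi])]; simp
    -- The factor is the generalized inverse of `σ` applied to `ρ`.
    refine ⟨conjDiag U (fun i => (q i)⁻¹) * ρ, ?_⟩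
    rw [← Matrix.mul_assoc, conjDiag_mul_conjDiag hU]
    have : conjDiag U (fun k => q k * (q k)⁻¹) * ρ =
        U * (diagonal (fun k => ((q k * (q k)⁻¹ : ℝ) : ℂ)) * (Uᴴ * ρ * U)) * Uᴴ := by
      rw [conjDiag]
      calc _ = U * diagonal (fun k => ((q k * (q k)⁻¹ : ℝ) : ℂ)) * Uᴴ * ρ * (U * Uᴴ) := by
            rw [hU.right]; simp
        _ = _ := by simp only [Matrix.mul_assoc]
    rw [this]
    conv_lhs => rw [hρG]
    congr 2
    ext i j
    rw [diagonal_mul]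
    by_cases hi : q i = 0
    · rw [hrow i hi]; simp
    · rw [mul_inv_cancel₀ hi]; simp

end Domination

/-! ### Measurements, with loss -/

section MeasurementOneShot

variable {ι η T : Type*} [Fintype ι] [DecidableEq ι] [Fintype η] [DecidableEq η]
  [Fintype T] [DecidableEq T] {m : T → Type*} [∀ c, Fintype (m c)] [∀ c, DecidableEq (m c)] {α : ℝ}

theorem conjTranspose_mul_self_diag {κ : Type*} (G : Matrix η κ ℂ) (i : κ) :
    ((Gᴴ * G) i i).re = ∑ k, Complex.normSq (G k i) := by
  rw [Matrix.mul_apply, Complex.re_sum]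
  refine Finset.sum_congr rfl fun k _ => ?_
  simp [Complex.normSq_apply]

theorem one_sub_posSemidef_of_idempotent {P : Matrix ι ι ℂ} (h1 : P.IsHermitian) (h2 : P * P = P) :
    (1 - P).PosSemidef := by
  have : 1 - P = (1 - P)ᴴ * (1 - P) := by
    rw [conjTranspose_sub, h1.eq, conjTranspose_one, Matrix.mul_sub, Matrix.sub_mul, Matrix.sub_mul,
      h2]
    simp
  rw [this]
  exact posSemidef_conjTranspose_mul_self _

/-- Since `Fᴴ * F` is a projection, `F` acts as a possibly incomplete measurement: the outcome
weights of a unit vector sum to at most one. -/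
theorem sum_normSq_col_le_one {F : Matrix η ι ℂ} (hF : Fᴴ * F * (Fᴴ * F) = Fᴴ * F) {κ : Type*}
    [Fintype κ] [DecidableEq κ] {U : Matrix ι κ ℂ} (hU : IsUnitary U) (i : κ) :
    ∑ k, Complex.normSq ((F * U) k i) ≤ 1 := by
  have h := one_sub_posSemidef_of_idempotent (isHermitian_conjTranspose_mul_self F) hF
  have h := PosSemidef.diag_re_nonneg (h.conjTranspose_mul_mul_same U) i
  rw [← conjTranspose_mul_self_diag]
  have e : Uᴴ * (1 - Fᴴ * F) * U = 1 - (F * U)ᴴ * (F * U) := by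
    rw [Matrix.mul_sub, Matrix.sub_mul, Matrix.mul_one, hU.left, conjTranspose_mul]
    simp only [Matrix.mul_assoc]
  rw [e] at h
  simpa using h

/-- Monotonicity under measurements, up to the number of eigenspaces of `σ`. -/
theorem sum_persp_measure_le_card (hα : 1 < α) {F : Matrix η ι ℂ}
    (hF : Fᴴ * F * (Fᴴ * F) = Fᴴ * F) {W : Matrix ι (Σ c, m c) ℂ} (hW : IsUnitary W) {g : T → ℝ}
    (hg : ∀ c, 0 ≤ g c) {ρ σ : Matrix ι ι ℂ} (hρ : ρ.PosSemidef)
    (hσ : σ = conjDiag W (fun i => g i.1)) (h : Dom ρ σ) :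
    ∑ k, persp α ((F * ρ * Fᴴ) k k).re ((F * σ * Fᴴ) k k).re ≤
      (Fintype.card T : ℝ) ^ α * sandwichedTrace α ρ σ := by
  obtain ⟨U, hU, hWU, hle⟩ := exists_pinching hW g hρ
  rw [hWU] at hσ
  set p : (Σ c, m c) → ℝ := fun i => ((Uᴴ * ρ * U) i i).re with hpdef
  have hp : ∀ i, 0 ≤ p i := fun i => PosSemidef.diag_re_nonneg (hρ.conjTranspose_mul_mul_same U) i
  have hpq : ∀ i, g i.1 = 0 → p i = 0 := fun i hi => by
    have h' := h.conj Uᴴ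
    rw [conjTranspose_conjTranspose, hσ, conjTranspose_mul_conjDiag_mul hU] at h'
    exact h'.diag_eq_zero (hρ.conjTranspose_mul_mul_same U) (by simp [hi])
  have hk : ∀ k, persp α ((F * ρ * Fᴴ) k k).re ((F * σ * Fᴴ) k k).re ≤
      (Fintype.card T : ℝ) ^ α * ∑ i, Complex.normSq ((F * U) k i) * persp α (p i) (g i.1) := by
    intro k
    have hY : ((F * σ * Fᴴ) k k).re = ∑ i, Complex.normSq ((F * U) k i) * g i.1 := by
      rw [hσ, mul_conjDiag_mul, conjDiag_apply_self, Complex.ofReal_re]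
    have hX : ((F * ρ * Fᴴ) k k).re ≤
        Fintype.card T * ∑ i, Complex.normSq ((F * U) k i) * p i := by
      have := PosSemidef.diag_re_nonneg (hle.mul_mul_conjTranspose_same F) k
      rw [Matrix.mul_sub, Matrix.sub_mul, mul_conjDiag_mul, Matrix.sub_apply, conjDiag_apply_self,
        Complex.sub_re, Complex.ofReal_re, sub_nonneg] at this
      refine this.trans (le_of_eq ?_)
      rw [Finset.mul_sum]
      exact Finset.sum_congr rfl fun i _ => by ring
    have hw := fun i => Complex.normSq_nonneg ((F * U) k i)
    rw [hY]
    refine (persp_le_mul_sum hα (fun i => mul_nonneg (hw i) (hp i))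
      (fun i => mul_nonneg (hw i) (hg i.1)) (fun i hi => ?_)
      (PosSemidef.diag_re_nonneg (hρ.mul_mul_conjTranspose_same F) k) (Nat.cast_nonneg _)
      hX).trans (le_of_eq ?_)
    · rcases mul_eq_zero.1 hi with h0 | h0
      · rw [h0, zero_mul]
      · rw [hpq i h0, mul_zero]
    · congr 1
      refine Finset.sum_congr rfl fun i _ => ?_
      rw [persp_mul (hw i) (hw i) (hp i) (hg i.1), persp_self hα (hw i)]
  refine (Finset.sum_le_sum fun k _ => hk k).trans ?_
  rw [← Finset.mul_sum]
  refine mul_le_mul_of_nonneg_left ?_ (by positivity)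
  rw [Finset.sum_comm, hσ]
  refine le_trans (Finset.sum_le_sum fun i _ => ?_) (sum_persp_diag_le hα hU (fun i => hg i.1) hρ)
  rw [← Finset.sum_mul]
  exact mul_le_of_le_one_left (persp_nonneg (hp i) (hg i.1)) (sum_normSq_col_le_one hF hU i)

end MeasurementOneShot

/-! ### Invariance under relabelling the basis -/

section Reindex

variable {ι ι' κ κ' : Type*} [Fintype ι] [DecidableEq ι] [Fintype ι'] [DecidableEq ι']
  [Fintype κ] [DecidableEq κ] [Fintype κ'] [DecidableEq κ'] {α : ℝ}

theorem IsUnitary.submatrix {U : Matrix ι κ ℂ} (hU : IsUnitary U) (e : ι' ≃ ι) (f : κ' ≃ κ) :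
    IsUnitary (U.submatrix e f) := by
  constructor
  · rw [conjTranspose_submatrix, submatrix_mul_equiv, hU.left, submatrix_one_equiv]
  · rw [conjTranspose_submatrix, submatrix_mul_equiv, hU.right, submatrix_one_equiv]

theorem conjDiag_submatrix (U : Matrix ι κ ℂ) (a : κ → ℝ) (e : ι' ≃ ι) (f : κ' ≃ κ) :
    (conjDiag U a).submatrix e e = conjDiag (U.submatrix e f) (fun k => a (f k)) := by
  have : diagonal (fun k => ((a (f k) : ℝ) : ℂ)) =
      (diagonal (fun k => ((a k : ℝ) : ℂ))).submatrix f f := by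
    rw [submatrix_diagonal_equiv]; rfl
  rw [conjDiag, conjDiag, this, conjTranspose_submatrix, submatrix_mul_equiv, submatrix_mul_equiv]

theorem rpow_submatrix {A : Matrix ι ι ℂ} (hA : A.PosSemidef) (e : ι' ≃ ι) (s : ℝ) :
    A.submatrix e e ^ s = (A ^ s).submatrix e e := by
  obtain ⟨U, a, hU, ha, rfl⟩ := exists_conjDiag_nonneg hA
  rw [conjDiag_submatrix U a e (Equiv.refl _), conjDiag_rpow (hU.submatrix e (Equiv.refl _))
    (fun k => ha _), conjDiag_rpow hU ha, conjDiag_submatrix U _ e (Equiv.refl _)]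

theorem trace_submatrix_equiv (A : Matrix ι ι ℂ) (e : ι' ≃ ι) :
    (A.submatrix e e).trace = A.trace := by
  simp only [Matrix.trace, diag_apply, submatrix_apply]
  exact e.sum_comp fun i => A i i

theorem sandwichedTrace_submatrix {ρ σ : Matrix ι ι ℂ} (hρ : ρ.PosSemidef) (hσ : σ.PosSemidef)
    (e : ι' ≃ ι) : sandwichedTrace α (ρ.submatrix e e) (σ.submatrix e e) = sandwichedTrace α ρ σ := by
  rw [sandwichedTrace, rpow_submatrix hσ, submatrix_mul_equiv, submatrix_mul_equiv,
    rpow_submatrix (PosSemidef.conj_rpow hρ _ _), trace_submatrix_equiv, sandwichedTrace]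

end Reindex

/-! ### Multiplicativity under tensor products -/

section Kronecker

variable {ι ι' κ κ' : Type*} [Fintype ι] [DecidableEq ι] [Fintype ι'] [DecidableEq ι']
  [Fintype κ] [DecidableEq κ] [Fintype κ'] [DecidableEq κ'] {α : ℝ}

theorem IsUnitary.kronecker {U : Matrix ι κ ℂ} {V : Matrix ι' κ' ℂ} (hU : IsUnitary U)
    (hV : IsUnitary V) : IsUnitary (U ⊗ₖ V) := by
  constructor
  · rw [conjTranspose_kronecker, ← mul_kronecker_mul, hU.left, hV.left, one_kronecker_one]
  · rw [conjTranspose_kronecker, ← mul_kronecker_mul, hU.right, hV.right, one_kronecker_one]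

theorem conjDiag_kronecker (U : Matrix ι κ ℂ) (V : Matrix ι' κ' ℂ) (a : κ → ℝ) (b : κ' → ℝ) :
    conjDiag U a ⊗ₖ conjDiag V b = conjDiag (U ⊗ₖ V) (fun k => a k.1 * b k.2) := by
  have : diagonal (fun k : κ × κ' => ((a k.1 * b k.2 : ℝ) : ℂ)) =
      diagonal (fun k => (a k : ℂ)) ⊗ₖ diagonal (fun k => (b k : ℂ)) := by
    rw [diagonal_kronecker_diagonal]; simp
  rw [conjDiag, conjDiag, conjDiag, this, conjTranspose_kronecker, ← mul_kronecker_mul,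
    ← mul_kronecker_mul]

theorem rpow_kronecker {A : Matrix ι ι ℂ} {B : Matrix κ κ ℂ} (hA : A.PosSemidef)
    (hB : B.PosSemidef) (s : ℝ) : (A ⊗ₖ B) ^ s = (A ^ s) ⊗ₖ (B ^ s) := by
  obtain ⟨U, a, hU, ha, rfl⟩ := exists_conjDiag_nonneg hA
  obtain ⟨V, b, hV, hb, rfl⟩ := exists_conjDiag_nonneg hB
  rw [conjDiag_kronecker, conjDiag_rpow (hU.kronecker hV) fun k => mul_nonneg (ha _) (hb _),
    conjDiag_rpow hU ha, conjDiag_rpow hV hb, conjDiag_kronecker]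
  simp only [Real.mul_rpow (ha _) (hb _)]

theorem PosSemidef.im_trace {A : Matrix ι ι ℂ} (hA : A.PosSemidef) : A.trace.im = 0 :=
  ((Complex.le_def.1 hA.trace_nonneg).2).symm

theorem sandwichedTrace_kronecker {ρ σ : Matrix ι ι ℂ} {ρ' σ' : Matrix κ κ ℂ}
    (hρ : ρ.PosSemidef) (hσ : σ.PosSemidef) (hρ' : ρ'.PosSemidef) (hσ' : σ'.PosSemidef) :
    sandwichedTrace α (ρ ⊗ₖ ρ') (σ ⊗ₖ σ') = sandwichedTrace α ρ σ * sandwichedTrace α ρ' σ' := by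
  rw [sandwichedTrace, rpow_kronecker hσ hσ', ← mul_kronecker_mul, ← mul_kronecker_mul,
    rpow_kronecker (PosSemidef.conj_rpow hρ _ _) (PosSemidef.conj_rpow hρ' _ _), trace_kronecker,
    Complex.mul_re, PosSemidef.im_trace (rpow_posSemidef _ _), zero_mul, sub_zero]
  rfl

end Kronecker

/-! ### Tensor powers, type counting, and removal of the loss -/

section TensorPower

variable {ι κ η : Type*} [Fintype ι] [DecidableEq ι] [Fintype κ] [DecidableEq κ]
  [Fintype η] [DecidableEq η] {α : ℝ}

/-- The `n`-fold tensor power of a matrix. -/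
def tpow (n : ℕ) (A : Matrix ι κ ℂ) : Matrix (Fin n → ι) (Fin n → κ) ℂ :=
  of fun u v => ∏ i, A (u i) (v i)

theorem tpow_mul (n : ℕ) (A : Matrix ι κ ℂ) (B : Matrix κ η ℂ) :
    tpow n (A * B) = tpow n A * tpow n B := by
  ext u v
  simp only [tpow, of_apply, Matrix.mul_apply, Finset.prod_univ_sum, Fintype.piFinset_univ,
    Finset.prod_mul_distrib]

theorem tpow_conjTranspose (n : ℕ) (A : Matrix ι κ ℂ) : tpow n Aᴴ = (tpow n A)ᴴ := by
  ext u v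
  simp [tpow]

theorem tpow_diagonal (n : ℕ) (a : ι → ℂ) :
    tpow n (diagonal a) = diagonal fun u => ∏ i, a (u i) := by
  ext u v
  rw [tpow, of_apply, diagonal_apply]
  split_ifs with h
  · subst h; simp
  · obtain ⟨i, hi⟩ := Function.ne_iff.1 h
    exact Finset.prod_eq_zero (Finset.mem_univ i) (diagonal_apply_ne _ hi)

theorem tpow_one (n : ℕ) : tpow n (1 : Matrix ι ι ℂ) = 1 := by
  rw [← diagonal_one, tpow_diagonal]; simp

theorem IsUnitary.tpow {U : Matrix ι κ ℂ} (hU : IsUnitary U) (n : ℕ) :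
    IsUnitary (SandwichedRenyi.tpow n U) := by
  constructor
  · rw [← tpow_conjTranspose, ← tpow_mul, hU.left, tpow_one]
  · rw [← tpow_conjTranspose, ← tpow_mul, hU.right, tpow_one]

theorem tpow_conjDiag (n : ℕ) (U : Matrix ι κ ℂ) (a : κ → ℝ) :
    tpow n (conjDiag U a) = conjDiag (tpow n U) (fun u => ∏ i, a (u i)) := by
  rw [conjDiag, tpow_mul, tpow_mul, tpow_diagonal, tpow_conjTranspose, conjDiag]
  simp

theorem tpow_posSemidef {A : Matrix ι ι ℂ} (hA : A.PosSemidef) (n : ℕ) : (tpow n A).PosSemidef := by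
  obtain ⟨U, a, hU, ha, rfl⟩ := exists_conjDiag_nonneg hA
  rw [tpow_conjDiag]
  exact conjDiag_posSemidef _ fun u => Finset.prod_nonneg fun i _ => ha _

theorem rpow_tpow {A : Matrix ι ι ℂ} (hA : A.PosSemidef) (n : ℕ) (s : ℝ) :
    tpow n A ^ s = tpow n (A ^ s) := by
  obtain ⟨U, a, hU, ha, rfl⟩ := exists_conjDiag_nonneg hA
  rw [tpow_conjDiag, conjDiag_rpow (hU.tpow n) fun u => Finset.prod_nonneg fun i _ => ha _,
    conjDiag_rpow hU ha, tpow_conjDiag]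
  congr 1
  funext u
  exact (Real.finsetProd_rpow _ _ (fun i _ => ha _) s).symm

theorem trace_tpow (n : ℕ) (A : Matrix ι ι ℂ) : (tpow n A).trace = A.trace ^ n := by
  simp only [Matrix.trace, tpow, diag_apply, of_apply]
  rw [← Fintype.piFinset_univ, ← Finset.prod_univ_sum (fun _ => Finset.univ) fun _ j => A j j]
  simp

theorem sandwichedTrace_tpow {ρ σ : Matrix ι ι ℂ} (hρ : ρ.PosSemidef) (hσ : σ.PosSemidef) (n : ℕ) :
    sandwichedTrace α (tpow n ρ) (tpow n σ) = sandwichedTrace α ρ σ ^ n := by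
  have h : ((((σ ^ ((1 - α) / (2 * α)) * ρ * σ ^ ((1 - α) / (2 * α))) ^ α).trace.re : ℝ) : ℂ) =
      ((σ ^ ((1 - α) / (2 * α)) * ρ * σ ^ ((1 - α) / (2 * α))) ^ α).trace :=
    Complex.ext rfl (PosSemidef.im_trace (rpow_posSemidef _ _)).symm
  rw [sandwichedTrace, rpow_tpow hσ, ← tpow_mul, ← tpow_mul,
    rpow_tpow (PosSemidef.conj_rpow hρ _ _), trace_tpow, sandwichedTrace, ← h, ← Complex.ofReal_pow,
    Complex.ofReal_re]
  simp

/-- The factorization `ρ = σ * Z` of the support inclusion is visibly preserved by tensor powers. -/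
theorem Dom.tpow {ρ σ : Matrix ι ι ℂ} (h : Dom ρ σ) (hρ : ρ.PosSemidef) (hσ : σ.PosSemidef)
    (n : ℕ) : Dom (SandwichedRenyi.tpow n ρ) (SandwichedRenyi.tpow n σ) := by
  rw [← supp_le_iff_dom hρ hσ, supp_le_iff_exists_mul] at h
  rw [← supp_le_iff_dom (tpow_posSemidef hρ n) (tpow_posSemidef hσ n), supp_le_iff_exists_mul]
  obtain ⟨Z, rfl⟩ := h
  exact ⟨SandwichedRenyi.tpow n Z, tpow_mul _ _ _⟩

/-- The type of a sequence: how often each letter occurs in it. -/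
def seqType (n : ℕ) (u : Fin n → ι) : ι → Fin (n + 1) := fun j =>
  ⟨(Finset.univ.filter fun i => u i = j).card,
    Nat.lt_succ_of_le ((Finset.card_le_univ _).trans_eq (Fintype.card_fin n))⟩

theorem prod_eq_prod_pow_seqType (n : ℕ) (a : ι → ℝ) (u : Fin n → ι) :
    ∏ i, a (u i) = ∏ j, a j ^ (seqType n u j : ℕ) := by
  rw [← Finset.prod_fiberwise Finset.univ u]
  refine Finset.prod_congr rfl fun j _ => ?_
  rw [Finset.prod_congr rfl (g := fun _ => a j) fun i hi => by rw [(Finset.mem_filter.1 hi).2],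
    Finset.prod_const]
  rfl

/-- The `n`-th tensor power of `σ` has at most polynomially many eigenvalues. -/
theorem exists_conjDiag_tpow {σ : Matrix ι ι ℂ} (hσ : σ.PosSemidef) (n : ℕ) {ι' : Type*}
    [Fintype ι'] [DecidableEq ι'] (e : ι' ≃ (Fin n → ι)) :
    ∃ (W : Matrix ι' (Σ c : ι → Fin (n + 1), {u // seqType n u = c}) ℂ)
      (g : (ι → Fin (n + 1)) → ℝ), IsUnitary W ∧ (∀ c, 0 ≤ g c) ∧
        (tpow n σ).submatrix e e = conjDiag W (fun i => g i.1) := by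
  obtain ⟨U, a, hU, ha, rfl⟩ := exists_conjDiag_nonneg hσ
  -- A product eigenvalue depends only on the type of its sequence, so the eigenvectors are grouped
  -- by type. Distinct types may share an eigenvalue, which does no harm.
  refine ⟨(tpow n U).submatrix e (Equiv.sigmaFiberEquiv (seqType n)), fun c => ∏ j, a j ^ (c j : ℕ),
    (hU.tpow n).submatrix _ _, fun c => Finset.prod_nonneg fun j _ => pow_nonneg (ha j) _, ?_⟩
  rw [tpow_conjDiag, conjDiag_submatrix _ _ e (Equiv.sigmaFiberEquiv (seqType n))]
  congr 1
  funext i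
  obtain ⟨c, u, rfl⟩ := i
  exact prod_eq_prod_pow_seqType n a u

/-- All candidate count vectors are included, even those not summing to `n`; only polynomial growth
matters. -/
theorem card_seqType (n : ℕ) :
    (Fintype.card (ι → Fin (n + 1)) : ℝ) = ((n : ℝ) + 1) ^ Fintype.card ι := by
  simp

theorem persp_prod {n : ℕ} {p q : Fin n → ℝ} (hp : ∀ i, 0 ≤ p i) (hq : ∀ i, 0 ≤ q i) :
    persp α (∏ i, p i) (∏ i, q i) = ∏ i, persp α (p i) (q i) := by
  simp only [persp, Finset.prod_mul_distrib]
  rw [Real.finsetProd_rpow _ _ fun i _ => hp i, Real.finsetProd_rpow _ _ fun i _ => hq i]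

/-- If `a ^ n ≤ c (n) b ^ n` with `c` of polynomial growth, then `a ≤ b`. -/
theorem le_of_pow_le_rpow_mul_pow {a b s : ℝ} (ha : 0 ≤ a) (hb : 0 ≤ b)
    (h : ∀ n : ℕ, 1 ≤ n → a ^ n ≤ ((n : ℝ) + 1) ^ s * b ^ n) : a ≤ b := by
  by_contra! hab
  have ha' : 0 < a := hb.trans_lt hab
  obtain ⟨K, hK⟩ := exists_nat_ge s
  have hr : |b / a| < 1 := by
    rw [abs_of_nonneg (div_nonneg hb ha), div_lt_one ha']; exact hab
  have hlim := tendsto_pow_const_mul_const_pow_of_abs_lt_one K hr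
  -- The factor `2 ^ K` comes from `n + 1 ≤ 2 * n` for `n ≥ 1`.
  have hlim' : Tendsto (fun n : ℕ => 2 ^ K * ((n : ℝ) ^ K * (b / a) ^ n)) atTop (𝓝 0) := by
    simpa using hlim.const_mul ((2 : ℝ) ^ K)
  obtain ⟨n, hn, hn1⟩ := ((hlim'.eventually (gt_mem_nhds one_pos)).and
    (eventually_ge_atTop 1)).exists
  have hn1' : (1 : ℝ) ≤ n := by exact_mod_cast hn1
  have h1 := h n hn1
  have h2 : ((n : ℝ) + 1) ^ s ≤ 2 ^ K * (n : ℝ) ^ K := by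
    calc ((n : ℝ) + 1) ^ s ≤ ((n : ℝ) + 1) ^ (K : ℝ) :=
          Real.rpow_le_rpow_of_exponent_le (by linarith) hK
      _ = ((n : ℝ) + 1) ^ K := Real.rpow_natCast _ _
      _ ≤ (2 * n) ^ K := pow_le_pow_left₀ (by linarith) (by linarith) K
      _ = _ := mul_pow _ _ _
  have h3 : a ^ n ≤ 2 ^ K * (n : ℝ) ^ K * b ^ n :=
    h1.trans (mul_le_mul_of_nonneg_right h2 (pow_nonneg hb n))
  have h4 : (0 : ℝ) < a ^ n := pow_pos ha' n
  rw [div_pow, ← mul_assoc, ← mul_div_assoc, div_lt_one h4] at hn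
  linarith

/-- Monotonicity of the sandwiched Rényi divergence under measurements. -/
theorem sum_persp_measure_le (hα : 1 < α) {F : Matrix η ι ℂ} (hF : Fᴴ * F * (Fᴴ * F) = Fᴴ * F)
    {ρ σ : Matrix ι ι ℂ} (hρ : ρ.PosSemidef) (hσ : σ.PosSemidef) (h : Dom ρ σ) :
    ∑ k, persp α ((F * ρ * Fᴴ) k k).re ((F * σ * Fᴴ) k k).re ≤ sandwichedTrace α ρ σ := by
  have hX := hρ.mul_mul_conjTranspose_same F
  have hY := hσ.mul_mul_conjTranspose_same F
  -- Both sides are multiplicative under tensor powers. The exponent comes from `(n + 1) ^ card ι`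
  -- types, raised to `α`.
  refine le_of_pow_le_rpow_mul_pow (s := Fintype.card ι * α)
    (Finset.sum_nonneg fun k _ => persp_nonneg (PosSemidef.diag_re_nonneg hX k)
      (PosSemidef.diag_re_nonneg hY k)) (sandwichedTrace_nonneg ρ σ) fun n _ => ?_
  obtain ⟨W, g, hW, hg, hWσ⟩ := exists_conjDiag_tpow hσ n (Equiv.refl _)
  rw [Equiv.coe_refl, submatrix_id_id] at hWσ
  have hFn : (tpow n F)ᴴ * tpow n F * ((tpow n F)ᴴ * tpow n F) = (tpow n F)ᴴ * tpow n F := by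
    simp only [← tpow_conjTranspose, ← tpow_mul, hF]
  have key := sum_persp_measure_le_card hα hFn hW hg (tpow_posSemidef hρ n) hWσ (h.tpow hρ hσ n)
  rw [sandwichedTrace_tpow hρ hσ, card_seqType, ← Real.rpow_natCast_mul (by positivity)] at key
  refine le_trans (le_of_eq ?_) key
  have hdiag : ∀ (A : Matrix ι ι ℂ), A.PosSemidef → ∀ u : Fin n → η,
      ((tpow n F * tpow n A * (tpow n F)ᴴ) u u).re = ∏ i, ((F * A * Fᴴ) (u i) (u i)).re := by
    intro A hA u
    have hFA := hA.mul_mul_conjTranspose_same F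
    rw [← tpow_conjTranspose, ← tpow_mul, ← tpow_mul, tpow, of_apply]
    rw [Finset.prod_congr rfl fun i _ => (PosSemidef.ofReal_diag_re hFA (u i)).symm,
      ← Complex.ofReal_prod, Complex.ofReal_re]
  simp only [hdiag _ hρ, hdiag _ hσ, persp_prod (fun _ => PosSemidef.diag_re_nonneg hX _)
    (fun _ => PosSemidef.diag_re_nonneg hY _)]
  rw [← Fintype.piFinset_univ, ← Finset.prod_univ_sum (fun _ => Finset.univ)
    fun _ k => persp α ((F * ρ * Fᴴ) k k).re ((F * σ * Fᴴ) k k).re]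
  simp

end TensorPower

/-! ### Choi matrices and positivity of the extended maps -/

section Choi

variable {r x y : Type*} [Fintype r] [DecidableEq r] [Fintype x] [DecidableEq x]
  [Fintype y] [DecidableEq y]

theorem maxEntangled_block (a b : x) :
    (of fun c d => maxEntangled x (a, c) (b, d)) = single a b (1 : ℂ) := by
  ext c d
  simp only [maxEntangled, of_apply, Matrix.sum_apply, kroneckerMap_apply, single_apply]
  rw [Finset.sum_eq_single a, Finset.sum_eq_single b]
  · simp
  · intro j _ hj; simp [hj]
  · simp
  · intro i _ hi; simp [hi]
  · simp

theorem choi_apply (N : Matrix x x ℂ →ₗ[ℂ] Matrix y y ℂ) (a b : x) (s t : y) :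
    choi N (a, s) (b, t) = N (single a b 1) s t := by
  rw [← maxEntangled_block]; rfl

theorem apply_eq_sum_choi (N : Matrix x x ℂ →ₗ[ℂ] Matrix y y ℂ) (A : Matrix x x ℂ) (s t : y) :
    N A s t = ∑ a, ∑ b, A a b * choi N (a, s) (b, t) := by
  conv_lhs => rw [matrix_eq_sum_single A]
  simp only [map_sum, Matrix.sum_apply, choi_apply]
  refine Finset.sum_congr rfl fun a _ => Finset.sum_congr rfl fun b _ => ?_
  have h : single a b (A a b) = A a b • single a b (1 : ℂ) := by simp
  rw [h, map_smul, Matrix.smul_apply, smul_eq_mul]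

/-- A nonnegative matrix of matrices is positive semidefinite. -/
theorem flatten_posSemidef {P : CStarMatrix x x (Matrix y y ℂ)} (hP : 0 ≤ P) :
    (of fun p q : x × y => P p.1 q.1 p.2 q.2).PosSemidef := by
  rw [StarOrderedRing.nonneg_iff] at hP
  induction hP using AddSubmonoid.closure_induction with
  | mem P h =>
    obtain ⟨D, rfl⟩ := h
    let B : Matrix (x × y) (x × y) ℂ := of fun p q => D p.1 q.1 p.2 q.2
    have : (of fun p q : x × y => (star D * D) p.1 q.1 p.2 q.2) = Bᴴ * B := by
      ext ⟨a, s⟩ ⟨b, t⟩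
      rw [of_apply, CStarMatrix.mul_apply, Matrix.sum_apply, Matrix.mul_apply,
        Fintype.sum_prod_type]
      rfl
    rw [this]
    exact posSemidef_conjTranspose_mul_self B
  | zero => exact PosSemidef.zero
  | add P Q _ _ hP hQ => exact hP.add hQ

/-- The matrix of matrix units is `star C * C`, where `C` has the single nonzero row `a ↦ single a₀
a 1`. Complete positivity keeps it nonnegative, and flattening the image gives the Choi matrix. -/
theorem choi_posSemidef (N : Matrix x x ℂ →CP Matrix y y ℂ) : (choi N.toLinearMap).PosSemidef := by
  rcases isEmpty_or_nonempty x with hx | ⟨⟨a₀⟩⟩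
  · rw [show choi N.toLinearMap = 0 from Subsingleton.elim _ _]; exact PosSemidef.zero
  let C : CStarMatrix x x (Matrix x x ℂ) :=
    CStarMatrix.ofMatrix (of fun k a => if k = a₀ then single a₀ a 1 else 0)
  have h0 : 0 ≤ star C * C := star_mul_self_nonneg C
  have h1 := CompletelyPositiveMap.map_cstarMatrix_nonneg N _ h0
  have hC : ∀ a b, (star C * C) a b = single a b (1 : ℂ) := by
    intro a b
    rw [CStarMatrix.mul_apply, Finset.sum_eq_single a₀]
    · simp [C, CStarMatrix.star_apply, star_eq_conjTranspose]
    · intro k _ hk; simp [C, hk]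
    · simp
  have h2 := flatten_posSemidef h1
  have e : choi N.toLinearMap =
      of fun p q : x × y => (star C * C).map N p.1 q.1 p.2 q.2 := by
    ext ⟨a, s⟩ ⟨b, t⟩
    rw [choi_apply, of_apply, CStarMatrix.map_apply, hC]
    rfl
  rw [e]
  exact h2

/-- Reshape `ψ` into a matrix `Ψ` from `x` to `r`; then `ψ` is `Ψ ⊗ 1` applied to the maximally
entangled vector, and `Ψ` acts on the reference, where it commutes with `id ⊗ N`. -/
theorem idTensor_vecMulVec (N : Matrix x x ℂ →ₗ[ℂ] Matrix y y ℂ) (ψ : r × x → ℂ) :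
    idTensor r N (vecMulVec ψ (star ψ)) =
      ((of fun a b => ψ (a, b) : Matrix r x ℂ) ⊗ₖ (1 : Matrix y y ℂ)) * choi N *
        ((of fun a b => ψ (a, b) : Matrix r x ℂ) ⊗ₖ (1 : Matrix y y ℂ))ᴴ := by
  ext ⟨i, s⟩ ⟨j, t⟩
  have h1 : idTensor r N (vecMulVec ψ (star ψ)) (i, s) (j, t) =
      N (of fun a b => vecMulVec ψ (star ψ) (i, a) (j, b)) s t := rfl
  rw [h1, apply_eq_sum_choi, Matrix.mul_apply, Fintype.sum_prod_type, Finset.sum_comm]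
  refine Finset.sum_congr rfl fun b _ => ?_
  rw [Finset.sum_eq_single t]
  · rw [Matrix.mul_apply, Fintype.sum_prod_type, Finset.sum_mul]
    refine Finset.sum_congr rfl fun a _ => ?_
    rw [Finset.sum_eq_single s]
    · simp [vecMulVec_apply, kroneckerMap_apply]; ring
    · intro s' _ hs; simp [kroneckerMap_apply, hs.symm]
    · simp
  · intro t' _ ht; simp [kroneckerMap_apply, ht.symm]
  · simp

/-- The columns of a matrix with values in `ℂ^r ⊗ ℂ^x`, as matrices, tensored with the identity. -/
def colTensor (y : Type*) [DecidableEq y] {κ : Type*} (U : Matrix (r × x) κ ℂ) (k : κ) :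
    Matrix (r × y) (x × y) ℂ :=
  (of fun a b => U (a, b) k : Matrix r x ℂ) ⊗ₖ (1 : Matrix y y ℂ)

theorem idTensor_conjDiag {κ : Type*} [Fintype κ] [DecidableEq κ]
    (N : Matrix x x ℂ →ₗ[ℂ] Matrix y y ℂ) (U : Matrix (r × x) κ ℂ) (p : κ → ℝ) :
    idTensor r N (conjDiag U p) =
      ∑ k, p k • (colTensor y U k * choi N * (colTensor y U k)ᴴ) := by
  have : conjDiag U p = ∑ k, (p k : ℂ) • vecMulVec (fun i => U i k) (star fun i => U i k) := by
    ext i j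
    rw [conjDiag, Matrix.mul_apply, Matrix.sum_apply]
    refine Finset.sum_congr rfl fun k _ => ?_
    rw [mul_diagonal]
    simp [vecMulVec_apply]; ring
  rw [this, map_sum]
  refine Finset.sum_congr rfl fun k _ => ?_
  rw [map_smul, idTensor_vecMulVec]
  rfl

theorem idTensor_posSemidef {N : Matrix x x ℂ →ₗ[ℂ] Matrix y y ℂ} (hN : (choi N).PosSemidef)
    {A : Matrix (r × x) (r × x) ℂ} (hA : A.PosSemidef) : (idTensor r N A).PosSemidef := by
  obtain ⟨U, a, -, ha, rfl⟩ := exists_conjDiag_nonneg hA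
  rw [idTensor_conjDiag]
  exact posSemidef_sum _ fun k _ => (hN.mul_mul_conjTranspose_same _).smul (ha k)

theorem Dom.trans {ι : Type*} [Fintype ι] {A B C : Matrix ι ι ℂ} (h : Dom A B) (h' : Dom B C) :
    Dom A C := by
  obtain ⟨c, hc, h⟩ := h
  obtain ⟨c', hc', h'⟩ := h'
  refine ⟨c * c', mul_nonneg hc hc', ?_⟩
  have := (h'.smul hc).add h
  rwa [smul_sub, sub_add_sub_cancel, smul_smul] at this

/-- Compare both sides with `idTensor r M ρ`: domination of Choi matrices says that `c • M - N` has
a positive semidefinite Choi matrix, hence maps `ρ` to a positive matrix. -/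
theorem Dom.idTensor {N M : Matrix x x ℂ →ₗ[ℂ] Matrix y y ℂ} (hM : (choi M).PosSemidef)
    (h : Dom (choi N) (choi M)) {ρ σ : Matrix (r × x) (r × x) ℂ} (hρ : ρ.PosSemidef)
    (hρσ : Dom ρ σ) : Dom (SandwichedRenyi.idTensor r N ρ) (SandwichedRenyi.idTensor r M σ) := by
  refine Dom.trans (B := SandwichedRenyi.idTensor r M ρ) ?_ ?_
  · obtain ⟨c, hc, h⟩ := h
    refine ⟨c, hc, ?_⟩
    have e : choi (((c : ℂ) • M) - N) = c • choi M - choi N := by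
      ext ⟨a, s⟩ ⟨b, t⟩
      simp [choi_apply]
    exact idTensor_posSemidef (N := ((c : ℂ) • M) - N) (e ▸ h) hρ
  · obtain ⟨c, hc, h⟩ := hρσ
    refine ⟨c, hc, ?_⟩
    have := idTensor_posSemidef hM h
    rwa [map_sub, ← Complex.coe_smul, map_smul, Complex.coe_smul] at this

end Choi

/-! ### Polar decomposition -/

section Polar

variable {r x : Type*} [Fintype r] [DecidableEq r] [Fintype x] [DecidableEq x]

/-- Polar decomposition with a partial isometry. -/
theorem exists_polar (Ψ : Matrix r x ℂ) :
    ∃ V : Matrix r x ℂ, Ψ = V * (Ψᴴ * Ψ) ^ (1 / 2 : ℝ) ∧ Vᴴ * V * (Vᴴ * V) = Vᴴ * V := by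
  obtain ⟨U, a, hU, ha, hω⟩ := exists_conjDiag_nonneg (posSemidef_conjTranspose_mul_self Ψ)
  -- With `0⁻¹ = 0` this gives the generalized inverse of `(Ψᴴ * Ψ) ^ (1 / 2)`, and `e` the
  -- projection onto its support.
  let b : x → ℝ := fun i => (a i ^ (1 / 2 : ℝ))⁻¹
  let e : x → ℝ := fun i => if a i = 0 then 0 else 1
  have hsq : ∀ i, a i ^ (1 / 2 : ℝ) * a i ^ (1 / 2 : ℝ) = a i := fun i => by
    rw [← Real.sqrt_eq_rpow, Real.mul_self_sqrt (ha i)]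
  have hbe : ∀ i, b i * a i ^ (1 / 2 : ℝ) = e i := fun i => by
    by_cases h : a i = 0
    · simp [b, e, h]
    · have : a i ^ (1 / 2 : ℝ) ≠ 0 := (Real.rpow_pos_of_pos ((ha i).lt_of_ne' h) _).ne'
      simp only [b, e, if_neg h]; exact inv_mul_cancel₀ this
  have hV : (Ψ * conjDiag U b)ᴴ * (Ψ * conjDiag U b) = conjDiag U e := by
    rw [conjTranspose_mul, (conjDiag_isHermitian U b).eq]
    calc _ = conjDiag U b * (Ψᴴ * Ψ) * conjDiag U b := by simp only [Matrix.mul_assoc]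
      _ = _ := by
        rw [hω, conjDiag_mul_conjDiag hU, conjDiag_mul_conjDiag hU]
        congr 1
        funext i
        rw [← hsq i]
        calc _ = (b i * a i ^ (1 / 2 : ℝ)) * (b i * a i ^ (1 / 2 : ℝ)) := by ring
          _ = e i := by rw [hbe]; simp only [e]; split_ifs <;> simp
  refine ⟨Ψ * conjDiag U b, ?_, ?_⟩
  · have hZ : Ψ * conjDiag U (fun i => 1 - e i) = 0 := by
      rw [← conjTranspose_mul_self_eq_zero, conjTranspose_mul, (conjDiag_isHermitian U _).eq]
      calc _ = conjDiag U (fun i => 1 - e i) * (Ψᴴ * Ψ) * conjDiag U (fun i => 1 - e i) := by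
            simp only [Matrix.mul_assoc]
        _ = conjDiag U (fun _ => 0) := by
            rw [hω, conjDiag_mul_conjDiag hU, conjDiag_mul_conjDiag hU]
            congr 1
            funext i
            by_cases h : a i = 0 <;> simp [e, h]
        _ = 0 := by simp [conjDiag]
    rw [hω, conjDiag_rpow hU ha, Matrix.mul_assoc, conjDiag_mul_conjDiag hU]
    simp only [hbe]
    have h1 : conjDiag U (fun i => 1 - e i) = 1 - conjDiag U e := by
      have := map_sub (conjDiagHom U hU) 1 e
      rw [map_one] at this
      exact this
    rw [h1, Matrix.mul_sub, Matrix.mul_one, sub_eq_zero] at hZ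
    exact hZ
  · rw [hV, conjDiag_mul_conjDiag hU]
    congr 1
    funext i
    by_cases h : a i = 0 <;> simp [e, h]

end Polar

/-! ### The one-shot chain rule, with loss -/

section ChainOneShot

variable {r x y : Type*} [Fintype r] [DecidableEq r] [Fintype x] [DecidableEq x]
  [Fintype y] [DecidableEq y] {α : ℝ}

/-- For a pure input state the measured output divergence is bounded by the channel divergence. -/
theorem sum_persp_pure_le (hα : 1 < α) {J K : Matrix (x × y) (x × y) ℂ} (hJ : J.PosSemidef)
    (hK : K.PosSemidef) (h : Dom J K) {Q : ℝ}
    (hQ : ∀ ω : Matrix x x ℂ, ω.PosSemidef → ω.trace = 1 →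
      sandwichedTrace α (sqrtTensor y ω * J * sqrtTensor y ω)
        (sqrtTensor y ω * K * sqrtTensor y ω) ≤ Q)
    {κ η : Type*} [Fintype κ] [DecidableEq κ] [Fintype η] [DecidableEq η]
    {U : Matrix (r × x) κ ℂ} (hU : IsUnitary U) {V : Matrix (r × y) η ℂ} (hV : IsUnitary V) (i : κ) :
    ∑ k, persp α ((Vᴴ * (colTensor y U i * J * (colTensor y U i)ᴴ) * V) k k).re
      ((Vᴴ * (colTensor y U i * K * (colTensor y U i)ᴴ) * V) k k).re ≤ Q := by
  set Ψ : Matrix r x ℂ := of fun a b => U (a, b) i with hΨ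
  obtain ⟨X, hX, hXX⟩ := exists_polar Ψ
  set ω := Ψᴴ * Ψ with hω
  have hωpos : ω.PosSemidef := posSemidef_conjTranspose_mul_self Ψ
  have htr : ω.trace = 1 := by
    have h1 := congrFun (congrFun hU.left i) i
    rw [one_apply_eq, Matrix.mul_apply, Fintype.sum_prod_type, Finset.sum_comm] at h1
    exact h1
  have hs : (sqrtTensor y ω)ᴴ = sqrtTensor y ω := by
    rw [sqrtTensor, conjTranspose_kronecker, (rpow_posSemidef ω _).isHermitian.eq, conjTranspose_one]
  have hc : colTensor y U i = (X ⊗ₖ (1 : Matrix y y ℂ)) * sqrtTensor y ω := by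
    rw [sqrtTensor, ← mul_kronecker_mul, ← hX, Matrix.one_mul]; rfl
  -- The partial isometry of the polar decomposition is absorbed into the measurement; `Fᴴ * F` is
  -- still a projection.
  set F : Matrix η (x × y) ℂ := Vᴴ * (X ⊗ₖ (1 : Matrix y y ℂ)) with hF
  have hFF : Fᴴ * F = (Xᴴ * X) ⊗ₖ (1 : Matrix y y ℂ) := by
    rw [hF, conjTranspose_mul, conjTranspose_conjTranspose]
    calc _ = (X ⊗ₖ (1 : Matrix y y ℂ))ᴴ * (V * Vᴴ) * (X ⊗ₖ (1 : Matrix y y ℂ)) := by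
          simp only [Matrix.mul_assoc]
      _ = _ := by
          rw [hV.right, Matrix.mul_one, conjTranspose_kronecker, ← mul_kronecker_mul,
            conjTranspose_one, Matrix.one_mul]
  have hidem : Fᴴ * F * (Fᴴ * F) = Fᴴ * F := by
    rw [hFF, ← mul_kronecker_mul, hXX, Matrix.one_mul]
  have hconj : ∀ L : Matrix (x × y) (x × y) ℂ,
      Vᴴ * (colTensor y U i * L * (colTensor y U i)ᴴ) * V =
        F * (sqrtTensor y ω * L * sqrtTensor y ω) * Fᴴ := by
    intro L
    rw [hc, hF, conjTranspose_mul, conjTranspose_mul, hs, conjTranspose_conjTranspose]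
    simp only [Matrix.mul_assoc]
  have hpos : ∀ L : Matrix (x × y) (x × y) ℂ, L.PosSemidef →
      (sqrtTensor y ω * L * sqrtTensor y ω).PosSemidef := fun L hL => by
    have := hL.mul_mul_conjTranspose_same (sqrtTensor y ω)
    rwa [hs] at this
  have hdom := h.conj (sqrtTensor y ω)
  rw [hs] at hdom
  simp only [hconj]
  exact (sum_persp_measure_le hα hidem (hpos J hJ) (hpos K hK) hdom).trans (hQ ω hωpos htr)

variable {S T : Type*} [Fintype S] [DecidableEq S] [Fintype T] [DecidableEq T]
  {l : S → Type*} [∀ c, Fintype (l c)] [∀ c, DecidableEq (l c)]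
  {m : T → Type*} [∀ c, Fintype (m c)] [∀ c, DecidableEq (m c)]

/-- The chain rule up to the numbers of eigenspaces of the two second arguments. -/
theorem sandwichedTrace_idTensor_le (hα : 1 < α) {N M : Matrix x x ℂ →ₗ[ℂ] Matrix y y ℂ}
    (hN : (choi N).PosSemidef) (hM : (choi M).PosSemidef) (hNM : Dom (choi N) (choi M)) {Q : ℝ}
    (hQ0 : 0 ≤ Q) (hQ : ∀ ω : Matrix x x ℂ, ω.PosSemidef → ω.trace = 1 →
      sandwichedTrace α (sqrtTensor y ω * choi N * sqrtTensor y ω)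
        (sqrtTensor y ω * choi M * sqrtTensor y ω) ≤ Q)
    {ρ σ : Matrix (r × x) (r × x) ℂ} (hρ : ρ.PosSemidef) (hρσ : Dom ρ σ)
    {W : Matrix (r × x) (Σ c, l c) ℂ} (hW : IsUnitary W) {g : S → ℝ} (hg : ∀ c, 0 ≤ g c)
    (hσW : σ = conjDiag W (fun i => g i.1))
    {W' : Matrix (r × y) (Σ c, m c) ℂ} (hW' : IsUnitary W') {g' : T → ℝ} (hg' : ∀ c, 0 ≤ g' c)
    (hσW' : idTensor r M σ = conjDiag W' (fun i => g' i.1)) :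
    sandwichedTrace α (idTensor r N ρ) (idTensor r M σ) ≤
      (Fintype.card T : ℝ) ^ α * ((Fintype.card S : ℝ) ^ α * (Q * sandwichedTrace α ρ σ)) := by
  obtain ⟨U, hU, hWU, hle⟩ := exists_pinching hW g hρ
  obtain ⟨V, hV, hWV, hle'⟩ := exists_pinching hW' g' (idTensor_posSemidef hN hρ)
  rw [hWU] at hσW
  rw [hWV] at hσW'
  set p : (Σ c, l c) → ℝ := fun i => ((Uᴴ * ρ * U) i i).re with hpdef
  have hp : ∀ i, 0 ≤ p i := fun i => PosSemidef.diag_re_nonneg (hρ.conjTranspose_mul_mul_same U) i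
  have hpq : ∀ i, g i.1 = 0 → p i = 0 := fun i hi => by
    have h' := hρσ.conj Uᴴ
    rw [conjTranspose_conjTranspose, hσW, conjTranspose_mul_conjDiag_mul hU] at h'
    exact h'.diag_eq_zero (hρ.conjTranspose_mul_mul_same U) (by simp [hi])
  -- Weight of outcome `k` in the basis `V` when the map with Choi matrix `J` acts on the pure state
  -- given by column `i` of `U`.
  let out (J : Matrix (x × y) (x × y) ℂ) (i : Σ c, l c) (k : Σ c, m c) : ℝ :=
    ((Vᴴ * (colTensor y U i * J * (colTensor y U i)ᴴ) * V) k k).re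
  have hout : ∀ J : Matrix (x × y) (x × y) ℂ, J.PosSemidef → ∀ i k, 0 ≤ out J i k := fun J hJ i k =>
    PosSemidef.diag_re_nonneg
      ((hJ.mul_mul_conjTranspose_same _).conjTranspose_mul_mul_same V) k
  have hout0 : ∀ i k, out (choi M) i k = 0 → out (choi N) i k = 0 := fun i k hik => by
    have h' := (hNM.conj (colTensor y U i)).conj Vᴴ
    rw [conjTranspose_conjTranspose] at h'
    exact h'.diag_eq_zero ((hN.mul_mul_conjTranspose_same _).conjTranspose_mul_mul_same V) hik
  have hsum : ∀ (L : Matrix x x ℂ →ₗ[ℂ] Matrix y y ℂ) (a : (Σ c, l c) → ℝ) k,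
      ((Vᴴ * idTensor r L (conjDiag U a) * V) k k).re = ∑ i, a i * out (choi L) i k := by
    intro L a k
    rw [idTensor_conjDiag, Matrix.mul_sum, Matrix.sum_mul, Matrix.sum_apply, Complex.re_sum]
    refine Finset.sum_congr rfl fun i _ => ?_
    rw [Matrix.mul_smul, Matrix.smul_mul, Matrix.smul_apply, Complex.smul_re, smul_eq_mul]
  -- The basis `V` diagonalizes the second output, so its eigenvalues are exact mixtures; only the
  -- first argument loses a factor.
  have hg'k : ∀ k : Σ c, m c, g' k.1 = ∑ i, g i.1 * out (choi M) i k := by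
    intro k
    rw [← hsum, ← hσW, hσW', conjTranspose_mul_conjDiag_mul hV]
    simp
  rw [hσW']
  refine (sandwichedTrace_le_sum_persp hα hV (Nat.cast_nonneg _) (fun i => hg' i.1)
    (idTensor_posSemidef hN hρ) hle').trans (mul_le_mul_of_nonneg_left ?_ (by positivity))
  -- Joint convexity over the pure states `i`, followed by multiplicativity of `persp`, separates
  -- input weights from output weights.
  have hk : ∀ k, persp α ((Vᴴ * idTensor r N ρ * V) k k).re (g' k.1) ≤
      (Fintype.card S : ℝ) ^ α * ∑ i, persp α (p i) (g i.1) *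
        persp α (out (choi N) i k) (out (choi M) i k) := by
    intro k
    rw [hg'k]
    refine (persp_le_mul_sum hα (p := fun i => p i * out (choi N) i k) (c := Fintype.card S)
      (fun i => mul_nonneg (hp i) (hout _ hN i k))
      (fun i => mul_nonneg (hg i.1) (hout _ hM i k)) (fun i hi => ?_)
      (PosSemidef.diag_re_nonneg ((idTensor_posSemidef hN hρ).conjTranspose_mul_mul_same V) k)
      (Nat.cast_nonneg _) ?_).trans (le_of_eq ?_)
    · rcases mul_eq_zero.1 hi with h0 | h0
      · rw [hpq i h0, zero_mul]
      · rw [hout0 i k h0, mul_zero]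
    · have h1 := PosSemidef.diag_re_nonneg
        ((idTensor_posSemidef hN hle).conjTranspose_mul_mul_same V) k
      rw [map_sub, Matrix.mul_sub, Matrix.sub_mul, Matrix.sub_apply, Complex.sub_re, hsum,
        sub_nonneg] at h1
      refine h1.trans (le_of_eq ?_)
      rw [Finset.mul_sum]
      exact Finset.sum_congr rfl fun i _ => by ring
    · congr 1
      refine Finset.sum_congr rfl fun i _ => ?_
      rw [persp_mul (hp i) (hg i.1) (hout _ hN i k) (hout _ hM i k)]
  refine (Finset.sum_le_sum fun k _ => hk k).trans ?_
  rw [← Finset.mul_sum, Finset.sum_comm]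
  refine mul_le_mul_of_nonneg_left ?_ (by positivity)
  calc _ ≤ ∑ i, persp α (p i) (g i.1) * Q := by
        refine Finset.sum_le_sum fun i _ => ?_
        rw [← Finset.mul_sum]
        exact mul_le_mul_of_nonneg_left (sum_persp_pure_le hα hN hM hNM hQ hU hV i)
          (persp_nonneg (hp i) (hg i.1))
    _ = Q * ∑ i, persp α (p i) (g i.1) := by rw [← Finset.sum_mul, mul_comm]
    _ ≤ _ := by
        refine mul_le_mul_of_nonneg_left ?_ hQ0
        rw [hσW]
        exact sum_persp_diag_le hα hU (fun i => hg i.1) hρ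

end ChainOneShot

/-! ### Fekete's lemma -/

section Fekete

/-- Fekete's lemma for superadditive sequences of extended reals. -/
theorem tendsto_div_of_superadditive {u : ℕ → EReal}
    (h : ∀ m n, u m + u n ≤ u (m + n)) (h1 : u 1 ≠ ⊥) :
    Tendsto (fun n : ℕ => ((1 / n : ℝ) : EReal) * u n) atTop
      (𝓝 (⨆ (n : ℕ) (_ : 1 ≤ n), ((1 / n : ℝ) : EReal) * u n)) := by
  refine tendsto_order.2 ⟨fun a ha => ?_, fun a ha => ?_⟩
  · obtain ⟨m, hm⟩ := lt_iSup_iff.1 ha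
    obtain ⟨hm1, hm⟩ := lt_iSup_iff.1 hm
    obtain ⟨c, hac, hc⟩ := EReal.lt_iff_exists_real_btwn.1 hm
    obtain ⟨c', hcc', hc'⟩ := EReal.lt_iff_exists_real_btwn.1 hc
    -- A real lower bound for `u 1`, to be paid `n % m` times for the remainder.
    obtain ⟨v, -, hv⟩ := EReal.lt_iff_exists_real_btwn.1 (bot_lt_iff_ne_bot.2 h1)
    have hcc : c < c' := by exact_mod_cast hcc'
    have hm0 : (0 : ℝ) < m := by exact_mod_cast hm1
    have hum : ((m * c' : ℝ) : EReal) ≤ u m := by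
      have := mul_le_mul_of_nonneg_left hc'.le (EReal.coe_nonneg.2 hm0.le)
      rwa [← EReal.coe_mul, ← mul_assoc, ← EReal.coe_mul, mul_one_div_cancel hm0.ne',
        EReal.coe_one, one_mul] at this
    -- The count starts at one block because nothing is assumed about `u 0`.
    have hk : ∀ k : ℕ, (((k + 1 : ℕ) * (m * c') : ℝ) : EReal) ≤ u ((k + 1) * m) := by
      intro k
      induction k with
      | zero => simpa using hum
      | succ k ih =>
        refine le_trans (le_of_eq ?_) ((add_le_add ih hum).trans (le_of_le_of_eq (h _ _) ?_))
        · rw [← EReal.coe_add]; congr 1; push_cast; ring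
        · congr 1; ring
    have hkj : ∀ k j : ℕ, (((k + 1 : ℕ) * (m * c') + j * v : ℝ) : EReal) ≤ u ((k + 1) * m + j) := by
      intro k j
      induction j with
      | zero => simpa using hk k
      | succ j ih =>
        refine le_trans (le_of_eq ?_) ((add_le_add ih hv.le).trans (h _ _))
        rw [← EReal.coe_add]; congr 1; push_cast; ring
    filter_upwards [eventually_ge_atTop m,
      -- Beyond this threshold the remainder error, at most `m * |v - c'|`, is covered by the slack
      -- `n * (c' - c)`.
      tendsto_natCast_atTop_atTop.eventually_ge_atTop (m * |v - c'| / (c' - c))] with n hn hn'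
    refine hac.trans_le ?_
    have hn0 : (0 : ℝ) < n := by exact_mod_cast hm1.trans hn
    obtain ⟨k, hk'⟩ : ∃ k, n / m = k + 1 :=
      ⟨n / m - 1, (Nat.sub_add_cancel (Nat.div_pos hn hm1)).symm⟩
    have hdiv : (k + 1) * m + n % m = n := by
      rw [← hk', mul_comm]; exact Nat.div_add_mod n m
    have hu := hkj k (n % m)
    rw [hdiv] at hu
    have hcast : ((k + 1 : ℕ) : ℝ) * m + (n % m : ℕ) = n := by exact_mod_cast hdiv
    have hreal : n * c ≤ (k + 1 : ℕ) * (m * c') + (n % m : ℕ) * v := by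
      have e : ((k + 1 : ℕ) : ℝ) * (m * c') + (n % m : ℕ) * v =
          n * c' + (n % m : ℕ) * (v - c') := by rw [← hcast]; ring
      have h2 : -(m * |v - c'|) ≤ (n % m : ℕ) * (v - c') := by
        have hj : ((n % m : ℕ) : ℝ) ≤ m := by exact_mod_cast (Nat.mod_lt n hm1).le
        calc -(m * |v - c'|) ≤ -((n % m : ℕ) * |v - c'|) :=
              neg_le_neg (mul_le_mul_of_nonneg_right hj (abs_nonneg _))
          _ = (n % m : ℕ) * (-|v - c'|) := by ring
          _ ≤ _ := mul_le_mul_of_nonneg_left (neg_abs_le _) (Nat.cast_nonneg _)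
      rw [div_le_iff₀ (sub_pos.2 hcc)] at hn'
      rw [e]
      linarith
    have := mul_le_mul_of_nonneg_left ((EReal.coe_le_coe_iff.2 hreal).trans hu)
      (EReal.coe_nonneg.2 (one_div_pos.2 hn0).le)
    rwa [← EReal.coe_mul, ← mul_assoc, one_div_mul_cancel hn0.ne', one_mul] at this
  · filter_upwards [eventually_ge_atTop 1] with n hn
    exact (le_iSup₂ (f := fun (n : ℕ) (_ : 1 ≤ n) => ((1 / n : ℝ) : EReal) * u n) n hn).trans_lt ha

end Fekete

/-! ### Extended values and additivity of the divergence -/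

section Divergence

variable {ι κ ι' : Type*} [Fintype ι] [DecidableEq ι] [Fintype κ] [DecidableEq κ]
  [Fintype ι'] [DecidableEq ι'] {α : ℝ}

theorem log2_mul {a b : ℝ} (ha : 0 ≤ a) (hb : 0 ≤ b) : log2 (a * b) = log2 a + log2 b := by
  rcases ha.eq_or_lt with rfl | ha
  · simp [log2]
  rcases hb.eq_or_lt with rfl | hb
  · simp [log2]
  · rw [log2, log2, log2, if_pos ha, if_pos hb, if_pos (mul_pos ha hb),
      Real.logb_mul ha.ne' hb.ne', EReal.coe_add]

theorem mul_log2_le_iff (hα : 1 < α) {t : ℝ} (ht : 0 ≤ t) (c : ℝ) :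
    ((1 / (α - 1) : ℝ) : EReal) * log2 t ≤ (c : EReal) ↔ t ≤ (2 : ℝ) ^ ((α - 1) * c) := by
  have hα' : 0 < α - 1 := sub_pos.2 hα
  rcases ht.eq_or_lt with rfl | ht
  · rw [log2, if_neg (lt_irrefl _), EReal.coe_mul_bot_of_pos (one_div_pos.2 hα')]
    exact iff_of_true bot_le (by positivity)
  · rw [log2, if_pos ht, ← EReal.coe_mul, EReal.coe_le_coe_iff, ← Real.logb_le_iff_le_rpow one_lt_two ht,
      one_div, inv_mul_le_iff₀ hα']

theorem sandwichedDiv_of_dom {ρ σ : Matrix ι ι ℂ} (hρ : ρ.PosSemidef) (hσ : σ.PosSemidef)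
    (h : Dom ρ σ) : sandwichedDiv α ρ σ =
      ((1 / (α - 1) : ℝ) : EReal) * log2 (sandwichedTrace α ρ σ) :=
  if_pos ((supp_le_iff_dom hρ hσ).2 h)

theorem sandwichedDiv_of_not_dom {ρ σ : Matrix ι ι ℂ} (hρ : ρ.PosSemidef) (hσ : σ.PosSemidef)
    (h : ¬ Dom ρ σ) : sandwichedDiv α ρ σ = ⊤ :=
  if_neg fun h' => h ((supp_le_iff_dom hρ hσ).1 h')

theorem sandwichedDiv_zero_left (hα : 1 < α) (σ : Matrix ι ι ℂ) : sandwichedDiv α 0 σ = ⊥ := by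
  have h0 : ((0 : Matrix ι ι ℂ) ^ α) = 0 := CFC.zero_rpow (by linarith)
  have hs : supp (0 : Matrix ι ι ℂ) ≤ supp σ := supp_le_iff_exists_mul.2 ⟨0, by simp⟩
  rw [sandwichedDiv, if_pos hs, Matrix.mul_zero, Matrix.zero_mul, h0, trace_zero, log2,
    if_neg (by simp), EReal.coe_mul_bot_of_pos (one_div_pos.2 (sub_pos.2 hα))]

/-- In an eigenbasis of `σ` the pinched sum vanishes, which kills the diagonal of `ρ` where `q i ≠
0`; domination kills the rest. A positive semidefinite matrix with zero diagonal is zero. -/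
theorem eq_zero_of_sandwichedTrace_eq_zero (hα : 1 < α) {ρ σ : Matrix ι ι ℂ} (hρ : ρ.PosSemidef)
    (hσ : σ.PosSemidef) (h : Dom ρ σ) (h0 : sandwichedTrace α ρ σ = 0) : ρ = 0 := by
  obtain ⟨U, q, hU, hq, rfl⟩ := exists_conjDiag_nonneg hσ
  have hG := hρ.conjTranspose_mul_mul_same U
  have hp := fun i => PosSemidef.diag_re_nonneg hG i
  have hle := sum_persp_diag_le hα hU hq hρ
  rw [h0] at hle
  have hz := (Finset.sum_eq_zero_iff_of_nonneg fun i _ => persp_nonneg (α := α) (hp i) (hq i)).1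
    (le_antisymm hle (Finset.sum_nonneg fun i _ => persp_nonneg (hp i) (hq i)))
  have hdiag : ∀ i, ((Uᴴ * ρ * U) i i).re = 0 := by
    intro i
    by_cases hi : q i = 0
    · have h' := h.conj Uᴴ
      rw [conjTranspose_conjTranspose, conjTranspose_mul_conjDiag_mul hU] at h'
      exact h'.diag_eq_zero hG (by simp [hi])
    · have h1 := hz i (Finset.mem_univ i)
      rcases mul_eq_zero.1 h1 with h2 | h2
      · exact ((Real.rpow_eq_zero (hp i) (by linarith)).1 h2)
      · exact absurd h2 (Real.rpow_pos_of_pos ((hq i).lt_of_ne' hi) _).ne'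
  have hG0 : Uᴴ * ρ * U = 0 := by
    ext i j
    refine PosSemidef.row_eq_zero hG ?_ j
    rw [← PosSemidef.ofReal_diag_re hG, hdiag]; simp
  calc ρ = U * (Uᴴ * ρ * U) * Uᴴ := by
        calc ρ = (U * Uᴴ) * ρ * (U * Uᴴ) := by rw [hU.right]; simp
          _ = _ := by simp only [Matrix.mul_assoc]
    _ = 0 := by rw [hG0]; simp

theorem eq_zero_of_sandwichedDiv_eq_bot (hα : 1 < α) {ρ σ : Matrix ι ι ℂ} (hρ : ρ.PosSemidef)
    (hσ : σ.PosSemidef) (h : sandwichedDiv α ρ σ = ⊥) : ρ = 0 := by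
  by_cases hd : Dom ρ σ
  · refine eq_zero_of_sandwichedTrace_eq_zero hα hρ hσ hd ?_
    rw [sandwichedDiv_of_dom hρ hσ hd] at h
    by_contra h0
    rw [log2, if_pos ((sandwichedTrace_nonneg ρ σ).lt_of_ne' h0), ← EReal.coe_mul] at h
    exact EReal.coe_ne_bot _ h
  · rw [sandwichedDiv_of_not_dom hρ hσ hd] at h
    exact absurd h top_ne_bot

/-- Restrict to the block at an index `j` with `ρ' j j > 0` and divide by that entry. -/
theorem Dom.of_kronecker_left {ρ σ : Matrix ι ι ℂ} {ρ' σ' : Matrix κ κ ℂ}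
    (hρ' : ρ'.PosSemidef) (hσ' : σ'.PosSemidef) (h0 : ρ' ≠ 0)
    (h : Dom (ρ ⊗ₖ ρ') (σ ⊗ₖ σ')) : Dom ρ σ := by
  obtain ⟨c, hc, h⟩ := h
  obtain ⟨j, hj⟩ : ∃ j, 0 < (ρ' j j).re := by
    by_contra! hall
    refine h0 ?_
    ext i j
    refine PosSemidef.row_eq_zero hρ' ?_ j
    rw [← PosSemidef.ofReal_diag_re hρ',
      le_antisymm (hall i) (PosSemidef.diag_re_nonneg hρ' i)]; simp
  obtain ⟨p, hp⟩ : ∃ p : ℝ, ρ' j j = p := ⟨_, (PosSemidef.ofReal_diag_re hρ' j).symm⟩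
  obtain ⟨q, hq⟩ : ∃ q : ℝ, σ' j j = q := ⟨_, (PosSemidef.ofReal_diag_re hσ' j).symm⟩
  have hq0 : 0 ≤ q := by simpa [hq] using PosSemidef.diag_re_nonneg hσ' j
  rw [hp, Complex.ofReal_re] at hj
  have h1 := (h.submatrix fun i : ι => (i, j)).smul (inv_nonneg.2 hj.le)
  refine ⟨p⁻¹ * (c * q), mul_nonneg (inv_nonneg.2 hj.le) (mul_nonneg hc hq0), ?_⟩
  convert h1 using 1
  ext a b
  have hp' : (p : ℂ) ≠ 0 := by exact_mod_cast hj.ne'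
  simp only [Matrix.sub_apply, Matrix.smul_apply, submatrix_apply, kroneckerMap_apply, hp, hq,
    Complex.real_smul]
  push_cast
  field_simp

theorem kronecker_submatrix_swap (A : Matrix ι ι ℂ) (B : Matrix κ κ ℂ) :
    (A ⊗ₖ B).submatrix (Equiv.prodComm κ ι) (Equiv.prodComm κ ι) = B ⊗ₖ A := by
  ext i j
  simp [kroneckerMap_apply, mul_comm]

/-- Multiplicativity of the trace functional once infinite values are settled; `⊥ + ⊤ = ⊥` covers a
vanishing first argument. -/
theorem sandwichedDiv_add_le_kronecker (hα : 1 < α) {ρ σ : Matrix ι ι ℂ} {ρ' σ' : Matrix κ κ ℂ}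
    (hρ : ρ.PosSemidef) (hσ : σ.PosSemidef) (hρ' : ρ'.PosSemidef) (hσ' : σ'.PosSemidef)
    (e : ι' ≃ ι × κ) :
    sandwichedDiv α ρ σ + sandwichedDiv α ρ' σ' ≤
      sandwichedDiv α ((ρ ⊗ₖ ρ').submatrix e e) ((σ ⊗ₖ σ').submatrix e e) := by
  have hR := (hρ.kronecker hρ').submatrix e
  have hS := (hσ.kronecker hσ').submatrix e
  by_cases hd : Dom ((ρ ⊗ₖ ρ').submatrix e e) ((σ ⊗ₖ σ').submatrix e e)
  swap
  · rw [sandwichedDiv_of_not_dom hR hS hd]; exact le_top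
  by_cases h0 : ρ = 0
  · rw [h0, sandwichedDiv_zero_left hα, EReal.bot_add]; exact bot_le
  by_cases h0' : ρ' = 0
  · rw [h0', sandwichedDiv_zero_left hα, EReal.add_bot]; exact bot_le
  have hk : Dom (ρ ⊗ₖ ρ') (σ ⊗ₖ σ') := by
    have := hd.submatrix e.symm
    simpa using this
  have h1 := hk.of_kronecker_left hρ' hσ' h0'
  have h2 : Dom ρ' σ' := by
    have := hk.submatrix (Equiv.prodComm κ ι)
    rw [kronecker_submatrix_swap, kronecker_submatrix_swap] at this
    exact this.of_kronecker_left hρ hσ h0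
  rw [sandwichedDiv_of_dom hR hS hd, sandwichedDiv_of_dom hρ hσ h1, sandwichedDiv_of_dom hρ' hσ' h2,
    sandwichedTrace_submatrix (hρ.kronecker hρ') (hσ.kronecker hσ'),
    sandwichedTrace_kronecker hρ hσ hρ' hσ',
    log2_mul (sandwichedTrace_nonneg _ _) (sandwichedTrace_nonneg _ _),
    EReal.left_distrib_of_nonneg_of_ne_top
      (EReal.coe_nonneg.2 (one_div_pos.2 (sub_pos.2 hα)).le) (EReal.coe_ne_top _)]

end Divergence

/-! ### Superadditivity and degenerate values of the channel divergence -/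

section ChannelDivergence

variable {x y x₁ y₁ x₂ y₂ : Type*} [Fintype x] [DecidableEq x] [Fintype y] [DecidableEq y]
  [Fintype x₁] [DecidableEq x₁] [Fintype y₁] [DecidableEq y₁]
  [Fintype x₂] [DecidableEq x₂] [Fintype y₂] [DecidableEq y₂] {α : ℝ}

theorem sqrtTensor_isHermitian (ω : Matrix x x ℂ) : (sqrtTensor y ω).IsHermitian := by
  rw [Matrix.IsHermitian, sqrtTensor, conjTranspose_kronecker,
    (rpow_posSemidef ω _).isHermitian.eq, conjTranspose_one]

theorem sqrtTensor_conj_posSemidef {J : Matrix (x × y) (x × y) ℂ} (hJ : J.PosSemidef)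
    (ω : Matrix x x ℂ) : (sqrtTensor y ω * J * sqrtTensor y ω).PosSemidef := by
  have := hJ.mul_mul_conjTranspose_same (sqrtTensor y ω)
  rwa [(sqrtTensor_isHermitian ω).eq] at this

theorem Dom.sqrtTensor_conj {J K : Matrix (x × y) (x × y) ℂ} (h : Dom J K) (ω : Matrix x x ℂ) :
    Dom (sqrtTensor y ω * J * sqrtTensor y ω) (sqrtTensor y ω * K * sqrtTensor y ω) := by
  have := h.conj (sqrtTensor y ω)
  rwa [(sqrtTensor_isHermitian ω).eq] at this

/-- The equivalence that sorts two pairs of tensor factors. -/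
def sortEquiv (e : x ≃ x₁ × x₂) (f : y ≃ y₁ × y₂) : x × y ≃ (x₁ × y₁) × (x₂ × y₂) :=
  (e.prodCongr f).trans (Equiv.prodProdProdComm _ _ _ _)

theorem sqrtTensor_submatrix_kronecker (e : x ≃ x₁ × x₂) (f : y ≃ y₁ × y₂) {ω₁ : Matrix x₁ x₁ ℂ}
    {ω₂ : Matrix x₂ x₂ ℂ} (h₁ : ω₁.PosSemidef) (h₂ : ω₂.PosSemidef) :
    sqrtTensor y ((ω₁ ⊗ₖ ω₂).submatrix e e) =
      (sqrtTensor y₁ ω₁ ⊗ₖ sqrtTensor y₂ ω₂).submatrix (sortEquiv e f) (sortEquiv e f) := by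
  have h1 : (1 : Matrix y y ℂ) = ((1 : Matrix y₁ y₁ ℂ) ⊗ₖ (1 : Matrix y₂ y₂ ℂ)).submatrix f f := by
    rw [one_kronecker_one, submatrix_one_equiv]
  rw [sqrtTensor, rpow_submatrix (h₁.kronecker h₂), rpow_kronecker h₁ h₂, h1]
  ext ⟨a, s⟩ ⟨b, t⟩
  simp only [sqrtTensor, sortEquiv, kroneckerMap_apply, submatrix_apply, Equiv.trans_apply,
    Equiv.prodCongr_apply, Prod.map_apply, Equiv.prodProdProdComm_apply]
  ring

/-- Product inputs `ω₁ ⊗ ω₂` already attain the sum. -/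
theorem sandwichedChannelDiv_add_le (hα : 1 < α) (e : x ≃ x₁ × x₂) (f : y ≃ y₁ × y₂)
    {N M : Matrix x x ℂ →ₗ[ℂ] Matrix y y ℂ} {N₁ M₁ : Matrix x₁ x₁ ℂ →ₗ[ℂ] Matrix y₁ y₁ ℂ}
    {N₂ M₂ : Matrix x₂ x₂ ℂ →ₗ[ℂ] Matrix y₂ y₂ ℂ}
    (hN₁ : (choi N₁).PosSemidef) (hM₁ : (choi M₁).PosSemidef)
    (hN₂ : (choi N₂).PosSemidef) (hM₂ : (choi M₂).PosSemidef)
    (hN : choi N = (choi N₁ ⊗ₖ choi N₂).submatrix (sortEquiv e f) (sortEquiv e f))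
    (hM : choi M = (choi M₁ ⊗ₖ choi M₂).submatrix (sortEquiv e f) (sortEquiv e f)) :
    sandwichedChannelDiv α N₁ M₁ + sandwichedChannelDiv α N₂ M₂ ≤ sandwichedChannelDiv α N M := by
  refine EReal.add_le_of_forall_lt fun a ha b hb => ?_
  obtain ⟨ω₁, ha⟩ := lt_iSup_iff.1 ha
  obtain ⟨⟨hω₁, ht₁⟩, ha⟩ := lt_iSup_iff.1 ha
  obtain ⟨ω₂, hb⟩ := lt_iSup_iff.1 hb
  obtain ⟨⟨hω₂, ht₂⟩, hb⟩ := lt_iSup_iff.1 hb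
  refine (add_le_add ha.le hb.le).trans ((sandwichedDiv_add_le_kronecker hα
    (sqrtTensor_conj_posSemidef hN₁ ω₁) (sqrtTensor_conj_posSemidef hM₁ ω₁)
    (sqrtTensor_conj_posSemidef hN₂ ω₂) (sqrtTensor_conj_posSemidef hM₂ ω₂)
    (sortEquiv e f)).trans ?_)
  have hω : ((ω₁ ⊗ₖ ω₂).submatrix e e).PosSemidef ∧ ((ω₁ ⊗ₖ ω₂).submatrix e e).trace = 1 :=
    ⟨(hω₁.kronecker hω₂).submatrix e, by rw [trace_submatrix_equiv, trace_kronecker, ht₁, ht₂, one_mul]⟩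
  refine le_of_eq_of_le ?_ (le_iSup₂ (f := fun (ω : Matrix x x ℂ)
    (_ : ω.PosSemidef ∧ ω.trace = 1) => sandwichedDiv α (sqrtTensor y ω * choi N * sqrtTensor y ω)
      (sqrtTensor y ω * choi M * sqrtTensor y ω)) _ hω)
  simp only [hN, hM, sqrtTensor_submatrix_kronecker e f hω₁ hω₂, submatrix_mul_equiv,
    mul_kronecker_mul]

/-- The square root of the maximally mixed state is a positive multiple of the identity. -/
theorem exists_density_sqrtTensor [Nonempty x] : ∃ (ω : Matrix x x ℂ) (c : ℝ), 0 < c ∧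
    ω.PosSemidef ∧ ω.trace = 1 ∧ sqrtTensor y ω = c • 1 := by
  have hd : (0 : ℝ) < (Fintype.card x : ℝ)⁻¹ := by
    have := Fintype.card_pos (α := x)
    positivity
  have h1 : IsUnitary (1 : Matrix x x ℂ) := ⟨by simp, by simp⟩
  refine ⟨conjDiag (1 : Matrix x x ℂ) fun _ => (Fintype.card x : ℝ)⁻¹, ((Fintype.card x : ℝ)⁻¹) ^ (1 / 2 : ℝ),
    Real.rpow_pos_of_pos hd _, conjDiag_posSemidef _ fun _ => hd.le, ?_, ?_⟩
  · rw [trace_conjDiag h1]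
    simp
  · rw [sqrtTensor, conjDiag_rpow h1 fun _ => hd.le, conjDiag]
    ext ⟨a, s⟩ ⟨b, t⟩
    by_cases hab : a = b <;> by_cases hst : s = t <;>
      simp [kroneckerMap_apply, hab, hst]

/-- The maximally mixed input only rescales the Choi matrices. It thus detects when the channel
divergence is `⊥` or when domination fails. -/
theorem exists_sandwichedDiv_smul_le [Nonempty x] (N M : Matrix x x ℂ →ₗ[ℂ] Matrix y y ℂ) :
    ∃ c : ℝ, 0 < c ∧ sandwichedDiv α (c • choi N) (c • choi M) ≤ sandwichedChannelDiv α N M := by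
  obtain ⟨ω, c, hc, hω, ht, hs⟩ := exists_density_sqrtTensor (x := x) (y := y)
  refine ⟨c * c, mul_pos hc hc, le_of_eq_of_le ?_ (le_iSup₂ (f := fun (ω : Matrix x x ℂ)
    (_ : ω.PosSemidef ∧ ω.trace = 1) => sandwichedDiv α (sqrtTensor y ω * choi N * sqrtTensor y ω)
      (sqrtTensor y ω * choi M * sqrtTensor y ω)) ω ⟨hω, ht⟩)⟩
  simp only [hs, Matrix.smul_mul, Matrix.mul_smul, Matrix.one_mul, Matrix.mul_one, smul_smul]

theorem choi_eq_zero_of_sandwichedChannelDiv_eq_bot (hα : 1 < α) [Nonempty x]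
    {N M : Matrix x x ℂ →ₗ[ℂ] Matrix y y ℂ} (hN : (choi N).PosSemidef) (hM : (choi M).PosSemidef)
    (h : sandwichedChannelDiv α N M = ⊥) : choi N = 0 := by
  obtain ⟨c, hc, hle⟩ := exists_sandwichedDiv_smul_le (α := α) N M
  rw [h, le_bot_iff] at hle
  exact (smul_eq_zero.1 (eq_zero_of_sandwichedDiv_eq_bot hα (hN.smul hc.le) (hM.smul hc.le)
    hle)).resolve_left hc.ne'

theorem dom_choi_of_sandwichedChannelDiv_ne_top [Nonempty x]
    {N M : Matrix x x ℂ →ₗ[ℂ] Matrix y y ℂ} (hN : (choi N).PosSemidef) (hM : (choi M).PosSemidef)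
    (h : sandwichedChannelDiv α N M ≠ ⊤) : Dom (choi N) (choi M) := by
  obtain ⟨c, hc, hle⟩ := exists_sandwichedDiv_smul_le (α := α) N M
  by_contra hd
  refine h (top_le_iff.1 (le_of_eq_of_le (sandwichedDiv_of_not_dom (hN.smul hc.le) (hM.smul hc.le)
    fun h' => hd ?_).symm hle))
  obtain ⟨b, hb, h'⟩ := h'
  refine ⟨b, hb, ?_⟩
  have := h'.smul (inv_nonneg.2 hc.le)
  rwa [smul_comm b c, ← smul_sub, smul_smul, inv_mul_cancel₀ hc.ne', one_smul] at this

theorem sandwichedChannelDiv_of_choi_eq_zero (hα : 1 < α) {N M : Matrix x x ℂ →ₗ[ℂ] Matrix y y ℂ}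
    (h : choi N = 0) : sandwichedChannelDiv α N M = ⊥ := by
  refine iSup₂_eq_bot.2 fun ω _ => ?_
  rw [h, Matrix.mul_zero, Matrix.zero_mul, sandwichedDiv_zero_left hα]

theorem sandwichedChannelDiv_of_isEmpty [IsEmpty x] (N M : Matrix x x ℂ →ₗ[ℂ] Matrix y y ℂ) :
    sandwichedChannelDiv α N M = ⊥ :=
  iSup₂_eq_bot.2 fun ω hω => absurd hω.2 (by simp [Matrix.trace])

end ChannelDivergence

/-! ### Tensor powers of channels and removal of the loss -/

section TensorPowerChannel

variable {r x y : Type*} [Fintype r] [DecidableEq r] [Fintype x] [DecidableEq x]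
  [Fintype y] [DecidableEq y] {α : ℝ}

/-- The equivalence between pairs of sequences and sequences of pairs. -/
def zipEquiv (n : ℕ) (x y : Type*) : (Fin n → x) × (Fin n → y) ≃ (Fin n → x × y) :=
  (Equiv.arrowProdEquivProdArrow (Fin n) (fun _ => x) (fun _ => y)).symm

theorem idTensor_tensorPow (n : ℕ) (N : Matrix x x ℂ →ₗ[ℂ] Matrix y y ℂ)
    (A : Matrix (r × x) (r × x) ℂ) :
    idTensor (Fin n → r) (tensorPow n N) ((tpow n A).submatrix (zipEquiv n r x) (zipEquiv n r x)) =
      (tpow n (idTensor r N A)).submatrix (zipEquiv n r y) (zipEquiv n r y) := by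
  ext ⟨i, u⟩ ⟨j, v⟩
  exact congrFun (congrFun (tensorPow_prod n N fun k => of fun a b => A (i k, a) (j k, b)) u) v

theorem choi_tensorPow_apply (n : ℕ) (N : Matrix x x ℂ →ₗ[ℂ] Matrix y y ℂ) (a b : Fin n → x)
    (u v : Fin n → y) :
    choi (tensorPow n N) (a, u) (b, v) = ∏ i, choi N (a i, u i) (b i, v i) := by
  have h : single a b (1 : ℂ) = of fun c d => ∏ i, single (a i) (b i) (1 : ℂ) (c i) (d i) := by
    ext c d
    rw [of_apply, single_apply]
    split_ifs with h
    · obtain ⟨rfl, rfl⟩ := h; simp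
    · rw [not_and_or] at h
      rcases h with h | h <;> obtain ⟨i, hi⟩ := Function.ne_iff.1 h <;>
        exact (Finset.prod_eq_zero (Finset.mem_univ i) (by simp [hi])).symm
  rw [choi_apply, h, tensorPow_prod]
  simp only [choi_apply, of_apply]

theorem choi_tensorPow (n : ℕ) (N : Matrix x x ℂ →ₗ[ℂ] Matrix y y ℂ) :
    choi (tensorPow n N) = (tpow n (choi N)).submatrix (zipEquiv n x y) (zipEquiv n x y) := by
  ext ⟨a, u⟩ ⟨b, v⟩
  exact choi_tensorPow_apply n N a b u v

theorem choi_tensorPow_posSemidef {N : Matrix x x ℂ →ₗ[ℂ] Matrix y y ℂ} (hN : (choi N).PosSemidef)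
    (n : ℕ) : (choi (tensorPow n N)).PosSemidef := by
  rw [choi_tensorPow]
  exact (tpow_posSemidef hN n).submatrix _

theorem choi_eq_submatrix_tensorPow_one (N : Matrix x x ℂ →ₗ[ℂ] Matrix y y ℂ) :
    choi N = (choi (tensorPow 1 N)).submatrix (fun p => (fun _ => p.1, fun _ => p.2))
      (fun p => (fun _ => p.1, fun _ => p.2)) := by
  ext p q
  rw [submatrix_apply, choi_tensorPow_apply]
  simp

theorem choi_tensorPow_add (m n : ℕ) (N : Matrix x x ℂ →ₗ[ℂ] Matrix y y ℂ) :
    choi (tensorPow (m + n) N) = (choi (tensorPow m N) ⊗ₖ choi (tensorPow n N)).submatrix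
      (sortEquiv (Fin.appendEquiv m n).symm (Fin.appendEquiv m n).symm)
      (sortEquiv (Fin.appendEquiv m n).symm (Fin.appendEquiv m n).symm) := by
  ext ⟨a, u⟩ ⟨b, v⟩
  rw [choi_tensorPow_apply, Fin.prod_univ_add, submatrix_apply, kroneckerMap_apply]
  exact (congrArg₂ (· * ·) (choi_tensorPow_apply m N _ _ _ _)
    (choi_tensorPow_apply n N _ _ _ _)).symm

theorem sandwichedChannelDiv_tensorPow_superadditive (hα : 1 < α)
    {N M : Matrix x x ℂ →ₗ[ℂ] Matrix y y ℂ} (hN : (choi N).PosSemidef) (hM : (choi M).PosSemidef)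
    (m n : ℕ) :
    sandwichedChannelDiv α (tensorPow m N) (tensorPow m M) +
      sandwichedChannelDiv α (tensorPow n N) (tensorPow n M) ≤
        sandwichedChannelDiv α (tensorPow (m + n) N) (tensorPow (m + n) M) :=
  sandwichedChannelDiv_add_le hα _ _ (choi_tensorPow_posSemidef hN m)
    (choi_tensorPow_posSemidef hM m) (choi_tensorPow_posSemidef hN n)
    (choi_tensorPow_posSemidef hM n) (choi_tensorPow_add m n N) (choi_tensorPow_add m n M)

/-- The chain rule for the trace functional, given a bound on all tensor powers of the channels. -/
theorem sandwichedTrace_idTensor_le_mul (hα : 1 < α) {N M : Matrix x x ℂ →ₗ[ℂ] Matrix y y ℂ}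
    (hN : (choi N).PosSemidef) (hM : (choi M).PosSemidef) (hNM : Dom (choi N) (choi M)) {B : ℝ}
    (hB : 0 ≤ B) (hBn : ∀ n : ℕ, 1 ≤ n → ∀ ω : Matrix (Fin n → x) (Fin n → x) ℂ, ω.PosSemidef →
      ω.trace = 1 → sandwichedTrace α
        (sqrtTensor (Fin n → y) ω * choi (tensorPow n N) * sqrtTensor (Fin n → y) ω)
        (sqrtTensor (Fin n → y) ω * choi (tensorPow n M) * sqrtTensor (Fin n → y) ω) ≤ B ^ n)
    {ρ σ : Matrix (r × x) (r × x) ℂ} (hρ : ρ.PosSemidef) (hσ : σ.PosSemidef) (hρσ : Dom ρ σ) :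
    sandwichedTrace α (idTensor r N ρ) (idTensor r M σ) ≤ B * sandwichedTrace α ρ σ := by
  have hNρ := idTensor_posSemidef hN hρ
  have hMσ := idTensor_posSemidef hM hσ
  -- The two exponents come from the type counts for `idTensor r M σ` and for `σ`.
  refine le_of_pow_le_rpow_mul_pow
    (s := Fintype.card (r × y) * α + Fintype.card (r × x) * α) (sandwichedTrace_nonneg _ _)
    (mul_nonneg hB (sandwichedTrace_nonneg _ _)) fun n hn => ?_
  obtain ⟨W, g, hW, hg, hσW⟩ := exists_conjDiag_tpow hσ n (zipEquiv n r x)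
  obtain ⟨W', g', hW', hg', hσW'⟩ := exists_conjDiag_tpow hMσ n (zipEquiv n r y)
  rw [← idTensor_tensorPow] at hσW'
  have hdomN : Dom (choi (tensorPow n N)) (choi (tensorPow n M)) := by
    rw [choi_tensorPow, choi_tensorPow]
    exact (hNM.tpow hN hM n).submatrix _
  have key := sandwichedTrace_idTensor_le hα (choi_tensorPow_posSemidef hN n)
    (choi_tensorPow_posSemidef hM n) hdomN (pow_nonneg hB n) (hBn n hn)
    ((tpow_posSemidef hρ n).submatrix (zipEquiv n r x))
    ((hρσ.tpow hρ hσ n).submatrix (zipEquiv n r x)) hW hg hσW hW' hg' hσW'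
  rw [idTensor_tensorPow, idTensor_tensorPow,
    sandwichedTrace_submatrix (tpow_posSemidef hNρ n) (tpow_posSemidef hMσ n),
    sandwichedTrace_submatrix (tpow_posSemidef hρ n) (tpow_posSemidef hσ n),
    sandwichedTrace_tpow hNρ hMσ, sandwichedTrace_tpow hρ hσ, card_seqType, card_seqType,
    ← Real.rpow_natCast_mul (by positivity), ← Real.rpow_natCast_mul (by positivity)] at key
  refine key.trans (le_of_eq ?_)
  rw [Real.rpow_add (by positivity), mul_pow]
  ring

end TensorPowerChannel

/-! ### The regularized divergence and the chain rule -/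

section Regularized

variable {r x y : Type*} [Fintype r] [DecidableEq r] [Fintype x] [DecidableEq x]
  [Fintype y] [DecidableEq y] {α : ℝ}

theorem isEmpty_or_choi_eq_zero (hα : 1 < α) {N M : Matrix x x ℂ →ₗ[ℂ] Matrix y y ℂ}
    (hN : (choi N).PosSemidef) (hM : (choi M).PosSemidef)
    (h : sandwichedChannelDiv α (tensorPow 1 N) (tensorPow 1 M) = ⊥) :
    IsEmpty x ∨ choi N = 0 := by
  refine (isEmpty_or_nonempty x).imp_right fun hx => ?_
  have : Nonempty (Fin 1 → x) := ⟨fun _ => hx.some⟩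
  rw [choi_eq_submatrix_tensorPow_one, choi_eq_zero_of_sandwichedChannelDiv_eq_bot hα
    (choi_tensorPow_posSemidef hN 1) (choi_tensorPow_posSemidef hM 1) h]
  rfl

theorem sandwichedChannelDiv_tensorPow_eq_bot (hα : 1 < α) {N M : Matrix x x ℂ →ₗ[ℂ] Matrix y y ℂ}
    (h : IsEmpty x ∨ choi N = 0) {n : ℕ} (hn : 1 ≤ n) :
    sandwichedChannelDiv α (tensorPow n N) (tensorPow n M) = ⊥ := by
  rcases h with h | h
  · have : IsEmpty (Fin n → x) := ⟨fun a => h.false (a ⟨0, hn⟩)⟩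
    exact sandwichedChannelDiv_of_isEmpty _ _
  · refine sandwichedChannelDiv_of_choi_eq_zero hα ?_
    ext ⟨a, u⟩ ⟨b, v⟩
    rw [choi_tensorPow_apply, h]
    exact Finset.prod_eq_zero (Finset.mem_univ ⟨0, hn⟩) rfl

theorem idTensor_eq_zero {N : Matrix x x ℂ →ₗ[ℂ] Matrix y y ℂ} (h : IsEmpty x ∨ choi N = 0)
    (A : Matrix (r × x) (r × x) ℂ) : idTensor r N A = 0 := by
  rcases h with h | h
  · rw [Subsingleton.elim A 0, map_zero]
  · ext ⟨i, u⟩ ⟨j, v⟩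
    have : idTensor r N A (i, u) (j, v) = N (of fun a b => A (i, a) (j, b)) u v := rfl
    rw [this, apply_eq_sum_choi, h]
    simp

theorem tendsto_channelDivSeq (hα : 1 < α) {N M : Matrix x x ℂ →ₗ[ℂ] Matrix y y ℂ}
    (hN : (choi N).PosSemidef) (hM : (choi M).PosSemidef) :
    Tendsto (channelDivSeq α N M) atTop
      (𝓝 (⨆ (n : ℕ) (_ : 1 ≤ n), channelDivSeq α N M n)) := by
  -- Fekete's lemma needs the first term above `⊥`; if it equals `⊥`, all terms with `n ≥ 1` do.
  by_cases h : sandwichedChannelDiv α (tensorPow 1 N) (tensorPow 1 M) = ⊥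
  · have hb : ∀ n, 1 ≤ n → channelDivSeq α N M n = ⊥ := fun n hn => by
      rw [channelDivSeq, sandwichedChannelDiv_tensorPow_eq_bot hα
        (isEmpty_or_choi_eq_zero hα hN hM h) hn, EReal.coe_mul_bot_of_pos]
      have : (0 : ℝ) < n := by exact_mod_cast hn
      positivity
    rw [iSup₂_eq_bot.2 hb]
    exact tendsto_const_nhds.congr' ((eventually_ge_atTop 1).mono fun n hn => (hb n hn).symm)
  · exact tendsto_div_of_superadditive
      (fun m n => sandwichedChannelDiv_tensorPow_superadditive hα hN hM m n) h

/-- The regularized divergence is the supremum over the numbers of channel uses. -/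
theorem regSandwichedChannelDiv_eq_iSup (hα : 1 < α) {N M : Matrix x x ℂ →ₗ[ℂ] Matrix y y ℂ}
    (hN : (choi N).PosSemidef) (hM : (choi M).PosSemidef) :
    regSandwichedChannelDiv α N M = ⨆ (n : ℕ) (_ : 1 ≤ n), channelDivSeq α N M n :=
  (tendsto_channelDivSeq hα hN hM).limUnder_eq

/-- The limit is a supremum, so it bounds every number of channel uses, not just large ones. -/
theorem sandwichedChannelDiv_tensorPow_le (hα : 1 < α) {N M : Matrix x x ℂ →ₗ[ℂ] Matrix y y ℂ}
    (hN : (choi N).PosSemidef) (hM : (choi M).PosSemidef) {l : ℝ}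
    (hl : regSandwichedChannelDiv α N M ≤ l) {n : ℕ} (hn : 1 ≤ n) :
    sandwichedChannelDiv α (tensorPow n N) (tensorPow n M) ≤ ((n * l : ℝ) : EReal) := by
  rw [regSandwichedChannelDiv_eq_iSup hα hN hM] at hl
  have hn0 : (0 : ℝ) < n := by exact_mod_cast hn
  have h1 : ((1 / n : ℝ) : EReal) * sandwichedChannelDiv α (tensorPow n N) (tensorPow n M) ≤ l :=
    (le_iSup₂ (f := fun (n : ℕ) (_ : 1 ≤ n) => channelDivSeq α N M n) n hn).trans hl
  have := mul_le_mul_of_nonneg_left h1 (EReal.coe_nonneg.2 hn0.le)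
  rwa [← mul_assoc, ← EReal.coe_mul, mul_one_div_cancel hn0.ne', EReal.coe_one, one_mul,
    ← EReal.coe_mul] at this

theorem sandwichedDiv_idTensor_le (hα : 1 < α) {N M : Matrix x x ℂ →ₗ[ℂ] Matrix y y ℂ}
    (hN : (choi N).PosSemidef) (hM : (choi M).PosSemidef) {ρ σ : Matrix (r × x) (r × x) ℂ}
    (hρ : ρ.PosSemidef) (hσ : σ.PosSemidef) :
    sandwichedDiv α (idTensor r N ρ) (idTensor r M σ) ≤
      regSandwichedChannelDiv α N M + sandwichedDiv α ρ σ := by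
  by_cases hbot : sandwichedChannelDiv α (tensorPow 1 N) (tensorPow 1 M) = ⊥
  · rw [idTensor_eq_zero (isEmpty_or_choi_eq_zero hα hN hM hbot), sandwichedDiv_zero_left hα]
    exact bot_le
  have hL : regSandwichedChannelDiv α N M ≠ ⊥ := by
    intro h
    rw [regSandwichedChannelDiv_eq_iSup hα hN hM] at h
    simpa [channelDivSeq, hbot] using iSup₂_eq_bot.1 h 1 le_rfl
  by_cases hD : sandwichedDiv α ρ σ = ⊥
  · rw [eq_zero_of_sandwichedDiv_eq_bot hα hρ hσ hD, map_zero, sandwichedDiv_zero_left hα]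
    exact bot_le
  by_cases hLt : regSandwichedChannelDiv α N M = ⊤
  · rw [hLt, EReal.top_add_of_ne_bot hD]; exact le_top
  by_cases hDt : sandwichedDiv α ρ σ = ⊤
  · rw [hDt, EReal.add_top_of_ne_bot hL]; exact le_top
  lift regSandwichedChannelDiv α N M to ℝ using ⟨hLt, hL⟩ with l hl
  lift sandwichedDiv α ρ σ to ℝ using ⟨hDt, hD⟩ with d hd
  have hρσ : Dom ρ σ := by
    by_contra h
    exact hDt (hd.trans (sandwichedDiv_of_not_dom hρ hσ h))
  have hn := fun {n : ℕ} (hn : 1 ≤ n) => sandwichedChannelDiv_tensorPow_le hα hN hM hl.ge hn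
  have hx : Nonempty x := by
    by_contra hx
    rw [not_nonempty_iff] at hx
    exact hbot (sandwichedChannelDiv_tensorPow_eq_bot hα (Or.inl hx) le_rfl)
  -- Finiteness for a single use forces domination of the Choi matrices.
  have hNM : Dom (choi N) (choi M) := by
    have := dom_choi_of_sandwichedChannelDiv_ne_top (α := α) (choi_tensorPow_posSemidef hN 1)
      (choi_tensorPow_posSemidef hM 1) ((hn le_rfl).trans_lt (EReal.coe_lt_top _)).ne
    rw [choi_eq_submatrix_tensorPow_one N, choi_eq_submatrix_tensorPow_one M]
    exact this.submatrix _
  rw [sandwichedDiv_of_dom (idTensor_posSemidef hN hρ) (idTensor_posSemidef hM hσ)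
    (hNM.idTensor hM hρ hρσ), ← EReal.coe_add, mul_log2_le_iff hα (sandwichedTrace_nonneg _ _)]
  -- This base is `l` translated to the trace functional; its `n`-th power bounds the `n`-fold
  -- channels.
  have hB : (0 : ℝ) ≤ 2 ^ ((α - 1) * l) := by positivity
  have hd' : sandwichedTrace α ρ σ ≤ 2 ^ ((α - 1) * d) := by
    rw [← mul_log2_le_iff hα (sandwichedTrace_nonneg _ _), ← sandwichedDiv_of_dom hρ hσ hρσ, hd]
  refine (sandwichedTrace_idTensor_le_mul hα hN hM hNM hB (fun n hn1 ω hω ht => ?_) hρ hσ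
    hρσ).trans ((mul_le_mul_of_nonneg_left hd' hB).trans (le_of_eq ?_))
  · have hNMn := dom_choi_of_sandwichedChannelDiv_ne_top (α := α) (choi_tensorPow_posSemidef hN n)
      (choi_tensorPow_posSemidef hM n) ((hn hn1).trans_lt (EReal.coe_lt_top _)).ne
    have h1 := (le_iSup₂ (f := fun (ω : Matrix (Fin n → x) (Fin n → x) ℂ)
      (_ : ω.PosSemidef ∧ ω.trace = 1) => sandwichedDiv α
        (sqrtTensor (Fin n → y) ω * choi (tensorPow n N) * sqrtTensor (Fin n → y) ω)
        (sqrtTensor (Fin n → y) ω * choi (tensorPow n M) * sqrtTensor (Fin n → y) ω))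
      ω ⟨hω, ht⟩).trans (hn hn1)
    rw [sandwichedDiv_of_dom (sqrtTensor_conj_posSemidef (choi_tensorPow_posSemidef hN n) ω)
      (sqrtTensor_conj_posSemidef (choi_tensorPow_posSemidef hM n) ω) (hNMn.sqrtTensor_conj ω),
      mul_log2_le_iff hα (sandwichedTrace_nonneg _ _)] at h1
    refine h1.trans (le_of_eq ?_)
    rw [← Real.rpow_mul_natCast zero_le_two]
    congr 1
    ring
  · rw [← Real.rpow_add two_pos]
    congr 1
    ring

end Regularized

end SandwichedRenyi

end

theorem corollary4p2 {r x y : Type*} [Fintype r] [DecidableEq r] [Fintype x] [DecidableEq x]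
    [Fintype y] [DecidableEq y] (α : ℝ) (hα : 1 < α)
    (ρ σ : Matrix (r × x) (r × x) ℂ) (hρ : ρ.PosSemidef) (hσ : σ.PosSemidef)
    (N M : Matrix x x ℂ →CP Matrix y y ℂ) :
    -- the limit that defines the regularized divergence exists
    Tendsto (SandwichedRenyi.channelDivSeq α N.toLinearMap M.toLinearMap) atTop
      (𝓝 (SandwichedRenyi.regSandwichedChannelDiv α N.toLinearMap M.toLinearMap)) ∧
    -- the chain rule
    SandwichedRenyi.sandwichedDiv α
        (SandwichedRenyi.idTensor r N.toLinearMap ρ) (SandwichedRenyi.idTensor r M.toLinearMap σ) ≤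
      SandwichedRenyi.regSandwichedChannelDiv α N.toLinearMap M.toLinearMap +
        SandwichedRenyi.sandwichedDiv α ρ σ := by
  have hN := SandwichedRenyi.choi_posSemidef N
  have hM := SandwichedRenyi.choi_posSemidef M
  refine ⟨?_, SandwichedRenyi.sandwichedDiv_idTensor_le hα hN hM hρ hσ⟩
  rw [SandwichedRenyi.regSandwichedChannelDiv_eq_iSup hα hN hM]
  exact SandwichedRenyi.tendsto_channelDivSeq hα hN hM
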